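/- For $n\in\mathbb N$ let $L_n$ be the finite reflexive linear graph with vertex set $\{0,\dots,n\}$ and $x\,R\,y \iff |x-y|\le 1$, and let $\mathrm{Epi}(L_m,L_n)$ be the set of all strong homomorphisms $L_m\to L_n$, i.e. maps that preserve $R$ and such that every pair of $R$-related points of $L_n$ is the image of a pair of $R$-related points of $L_m$. Consider totally disconnected compact metrizable spaces $X$ equipped with sets $\mathrm{Epi}(X,L_n)$ of continuous surjections $X\to L_n$ ($n\in\mathbb N$) such that: (A1) every continuous map from $X$ to a finite discrete space has the form $f\circ\varphi$ with $\varphi\in\mathrm{Epi}(X,L_n)$ for some $n$ and $f$ a function on $L_n$; (A2) for all $\varphi\in\mathrm{Epi}(X,L_m)$ and $\psi\in\mathrm{Epi}(X,L_n)$ there are $k$, $\chi\in\mathrm{Epi}(X,L_k)$, $f\in\mathrm{Epi}(L_k,L_m)$ and $g\in\mathrm{Epi}(L_k,L_n)$ with $\varphi=f\circ\chi$ and $\psi=g\circ\chi$; (A3) $f\circ\varphi\in\mathrm{Epi}(X,L_n)$ whenever $\varphi\in\mathrm{Epi}(X,L_m)$ and $f\in\mathrm{Epi}(L_m,L_n)$.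 Let $\mathrm{Aut}(X)$ be the group of all homeomorphisms $\sigma$ of $X$ such that $\varphi\circ\sigma,\ \varphi\circ\sigma^{-1}\in\mathrm{Epi}(X,L_n)$ for all $n$ and all $\varphi\in\mathrm{Epi}(X,L_n)$. Such an $X$ is called a pre-pseudoarc (a projective Fraïssé limit of the finite reflexive linear graphs), and is denoted by $\mathbb P$, if moreover (P1) $\mathrm{Epi}(X,L_n)\neq\emptyset$ for every $n$, and (P2) for all $n$ and all $\varphi,\psi\in\mathrm{Epi}(X,L_n)$ there is $\sigma\in\mathrm{Aut}(X)$ with $\varphi=\psi\circ\sigma$. On $\mathbb P$ the relation $x\,R^{\mathbb P}\,y \iff \varphi(x)\,R\,\varphi(y)$ for all $n$ and all $\varphi\in\mathrm{Epi}(\mathbb P,L_n)$ is an equivalence relation; let $P=\mathbb P/R^{\mathbb P}$ be the quotient space, let $\mathrm{pr}\colon\mathrm{Aut}(\mathbb P)\to\mathrm{Homeo}(P)$ be the induced homomorphism, and regard tuples in $\mathrm{Aut}(\mathbb P)$ as tuples in $\mathrm{Homeo}(P)$ via $\mathrm{pr}$. (The space $P$ is known to be homeomorphic to the pseudoarc;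 this is a remark and not part of the statement.) The groups $\mathrm{Homeo}(P)$ and $\mathrm{Homeo}(\mathbb P)$ carry the topology of uniform convergence, i.e. the compact-open topology, $\mathrm{Aut}(\mathbb P)$ carries the subspace topology from $\mathrm{Homeo}(\mathbb P)$, and powers carry the product topology. A set is comeager if it contains a countable intersection of dense open sets. **Theorem.** A pre-pseudoarc exists, and for every pre-pseudoarc $\mathbb P$: (i) For every $n\in\mathbb N$, the set of all $\bar\gamma\in\mathrm{Aut}(\mathbb P)^n$ such that the orbit $\{(g\gamma_ig^{-1})_{i<n} : g\in\mathrm{Aut}(\mathbb P)\}$ of $\bar\gamma$ under diagonal conjugation by $\mathrm{Aut}(\mathbb P)$ is dense in $\mathrm{Homeo}(P)^n$ is comeager in $\mathrm{Aut}(\mathbb P)^n$. (ii) The set of all $\bar\gamma\in\mathrm{Aut}(\mathbb P)^{\mathbb N}$ such that the orbit $\{(g\gamma_ig^{-1})_{i\in\mathbb N} : g\in\mathrm{Aut}(\mathbb P)\}$ of $\bar\gamma$ under diagonal conjugation by $\mathrm{Aut}(\mathbb P)$ is dense in $\mathrm{Homeo}(P)^{\mathbb N}$ is comeager in $\mathrm{Aut}(\mathbb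 P)^{\mathbb N}$. -/

import Mathlib

namespace PreProj

/-- A strong homomorphism between sets with binary relations: it preserves the relation, and every
related pair of the codomain is the image of a related pair of the domain. -/
def IsStrongHom {A B : Type*} (r : A → A → Prop) (s : B → B → Prop) (f : A → B) : Prop :=
  (∀ a₁ a₂, r a₁ a₂ → s (f a₁) (f a₂)) ∧
    ∀ b₁ b₂, s b₁ b₂ → ∃ a₁ a₂, f a₁ = b₁ ∧ f a₂ = b₂ ∧ r a₁ a₂

/-- The finite reflexive linear graph on `{0, …, n}`: `x R y` iff `|x - y| ≤ 1`. Every finite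
reflexive linear graph is isomorphic to exactly one of these. -/
def PathRel (n : ℕ) (x y : Fin (n + 1)) : Prop :=
  |((x : ℕ) : ℤ) - ((y : ℕ) : ℤ)| ≤ 1

/-- `Epi(L_m, L_n)`: the morphisms between finite linear graphs are all strong homomorphisms. -/
def PathEpi (m n : ℕ) : Set (Fin (m + 1) → Fin (n + 1)) :=
  {f | IsStrongHom (PathRel m) (PathRel n) f}

/-- The structure of a pro-object of the class of finite linear graphs on a topological space `X`
(in the theorem `X` is a totally disconnected compact metrizable space): sets `Epi(X, L_n)` of
continuous surjections, subject to the three axioms below. -/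
structure ProPath (X : Type*) [TopologicalSpace X] where
  /-- the set `Epi(X, L_n)` -/
  Epi : ∀ n : ℕ, Set (X → Fin (n + 1))
  continuous_of_mem : ∀ {n} {φ : X → Fin (n + 1)}, φ ∈ Epi n → Continuous φ
  surjective_of_mem : ∀ {n} {φ : X → Fin (n + 1)}, φ ∈ Epi n → Function.Surjective φ
  /-- continuous maps to finite discrete spaces factor through some epimorphism -/
  factor : ∀ (Y : Type) [Finite Y] [TopologicalSpace Y] [DiscreteTopology Y] (ψ : X → Y),
    Continuous ψ → ∃ n, ∃ φ ∈ Epi n, ∃ f : Fin (n + 1) → Y, ψ = f ∘ φ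
  /-- any two epimorphisms factor through a common one -/
  cofinal : ∀ {m n} {φ : X → Fin (m + 1)} {ψ : X → Fin (n + 1)}, φ ∈ Epi m → ψ ∈ Epi n →
    ∃ k, ∃ χ ∈ Epi k, ∃ f ∈ PathEpi k m, ∃ g ∈ PathEpi k n, φ = f ∘ χ ∧ ψ = g ∘ χ
  /-- Closure under composition with morphisms. Since all strong homomorphisms between finite linear
  graphs are morphisms, the converse (`f` is a morphism if `f ∘ φ` is in `Epi(X, L_n)` for some `φ`
  and the strong homomorphism `f`) holds by definition. -/
  comp_mem : ∀ {m n} {φ : X → Fin (m + 1)} {f : Fin (m + 1) → Fin (n + 1)},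
    φ ∈ Epi m → f ∈ PathEpi m n → f ∘ φ ∈ Epi n

/-- The natural topology of `Homeo(X)`: the compact-open topology, i.e. for compact metrizable `X`
the topology of uniform convergence. -/
instance homeoTopology (X : Type*) [TopologicalSpace X] : TopologicalSpace (X ≃ₜ X) :=
  TopologicalSpace.induced (fun h => (⟨h, h.continuous⟩ : C(X, X))) ContinuousMap.compactOpen

variable {X : Type*} [TopologicalSpace X]

namespace ProPath

/-- `σ` is a morphism of pro-objects from `X` to itself (for `σ` a continuous surjection). -/
def IsMor (E : ProPath X) (σ : X → X) : Prop :=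
  ∀ n, ∀ φ ∈ E.Epi n, φ ∘ σ ∈ E.Epi n

/-- `Aut(X)`: all homeomorphisms `σ` such that `σ` and `σ⁻¹` are morphisms. It carries the subspace
topology from `Homeo(X)`. -/
def Aut (E : ProPath X) : Subgroup (X ≃ₜ X) where
  carrier := {σ | E.IsMor σ ∧ E.IsMor σ.symm}
  one_mem' := ⟨fun _ _ h => h, fun _ _ h => h⟩
  mul_mem' := by
    intro σ τ hσ hτ
    exact ⟨fun n φ h => hτ.1 n _ (hσ.1 n φ h), fun n φ h => hσ.2 n _ (hτ.2 n φ h)⟩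
  inv_mem' := by
    intro σ hσ
    exact ⟨hσ.2, hσ.1⟩

/-- `X` is the projective Fraïssé limit of the finite linear graphs: projective universality and
projective ultrahomogeneity. -/
structure IsLimit (E : ProPath X) : Prop where
  universal : ∀ n, (E.Epi n).Nonempty
  homogeneous : ∀ n, ∀ φ ∈ E.Epi n, ∀ ψ ∈ E.Epi n, ∃ σ ∈ E.Aut, φ = ψ ∘ σ

/-- The relation `R^X`. -/
def Rel (E : ProPath X) (x y : X) : Prop :=
  ∀ n, ∀ φ ∈ E.Epi n, PathRel n (φ x) (φ y)

theorem Rel.map {E : ProPath X} {σ : X ≃ₜ X} (hσ : σ ∈ E.Aut) {x y : X} (h : E.Rel x y) :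
    E.Rel (σ x) (σ y) :=
  fun n φ hφ => h n (φ ∘ σ) (hσ.1 n φ hφ)

theorem halving_mem (n : ℕ) :
    (fun i : Fin (2 * n + 1 + 1) => (⟨i / 2, by omega⟩ : Fin (n + 1))) ∈ PathEpi (2 * n + 1) n := by
  refine ⟨fun a b h => ?_, fun a b h => ?_⟩
  · simp only [PathRel, abs_le] at h ⊢
    omega
  · simp only [PathRel, abs_le] at h
    rcases lt_or_ge a.1 b.1 with hab | hab
    · refine ⟨⟨2 * a + 1, by omega⟩, ⟨2 * b, by omega⟩, ?_, ?_, ?_⟩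
      · ext; simp only; omega
      · ext; simp only; omega
      · simp only [PathRel, abs_le]; omega
    · rcases hab.eq_or_lt with hab | hab
      · refine ⟨⟨2 * a, by omega⟩, ⟨2 * b, by omega⟩, ?_, ?_, ?_⟩
        · ext; simp only; omega
        · ext; simp only; omega
        · simp only [PathRel, abs_le]; omega
      · refine ⟨⟨2 * a, by omega⟩, ⟨2 * b + 1, by omega⟩, ?_, ?_, ?_⟩
        · ext; simp only; omega
        · ext; simp only; omega
        · simp only [PathRel, abs_le]; omega

theorem IsLimit.trans {E : ProPath X} (hE : E.IsLimit) {x y z : X} (hxy : E.Rel x y)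
    (hyz : E.Rel y z) : E.Rel x z := by
  intro n φ hφ
  obtain ⟨ψ, hψ⟩ := hE.universal (2 * n + 1)
  obtain ⟨σ, hσ, rfl⟩ := hE.homogeneous n φ hφ _ (E.comp_mem hψ (halving_mem n))
  have h₁ := Rel.map hσ hxy _ ψ hψ
  have h₂ := Rel.map hσ hyz _ ψ hψ
  simp only [PathRel, abs_le, Function.comp_apply] at h₁ h₂ ⊢
  omega

/-- On the limit, `R^X` is an equivalence relation. -/
def setoid (E : ProPath X) (hE : E.IsLimit) : Setoid X where
  r := E.Rel
  iseqv :=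
    { refl := fun x n φ _ => by simp [PathRel]
      symm := fun h n φ hφ => by
        have := h n φ hφ
        rwa [PathRel, abs_sub_comm] at this
      trans := fun h₁ h₂ => hE.trans h₁ h₂ }

/-- The quotient space `P = X / R^X`, with the quotient topology. -/
abbrev Quo (E : ProPath X) (hE : E.IsLimit) : Type _ :=
  Quotient (E.setoid hE)

/-- The homeomorphism of the quotient space induced by an automorphism. -/
def prHomeo (E : ProPath X) (hE : E.IsLimit) (σ : E.Aut) : E.Quo hE ≃ₜ E.Quo hE where
  toFun := Quotient.map σ.1 fun _ _ h => Rel.map σ.2 h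
  invFun := Quotient.map σ⁻¹.1 fun _ _ h => Rel.map σ⁻¹.2 h
  left_inv := by
    rintro ⟨x⟩
    exact congrArg (Quotient.mk _) (σ.1.symm_apply_apply x)
  right_inv := by
    rintro ⟨x⟩
    exact congrArg (Quotient.mk _) (σ.1.apply_symm_apply x)
  continuous_toFun := σ.1.continuous.quotient_map' _
  continuous_invFun := σ⁻¹.1.continuous.quotient_map' _

/-- The canonical homomorphism `pr : Aut(X) → Homeo(P)`. -/
def pr (E : ProPath X) (hE : E.IsLimit) : E.Aut →* (E.Quo hE ≃ₜ E.Quo hE) where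
  toFun := E.prHomeo hE
  map_one' := by
    ext ⟨x⟩
    rfl
  map_mul' := by
    intro σ τ
    ext ⟨x⟩
    rfl

/-- The orbit of the tuple `γ` in `Aut(X)^ι` under diagonal conjugation by `Aut(X)`, regarded as a
subset of `Homeo(P)^ι`. -/
def orbit (E : ProPath X) (hE : E.IsLimit) {ι : Type*} (γ : ι → E.Aut) :
    Set (ι → (E.Quo hE ≃ₜ E.Quo hE)) :=
  Set.range fun (g : E.Aut) (i : ι) => E.pr hE (g * γ i * g⁻¹)

end ProPath

end PreProj

/-!
Existence. Projective ultrahomogeneity needs amalgamation of strong homomorphisms `f : L_p → L_n`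
and `g : L_q → L_n`, which is the mountain climbing lemma `climb_of_le`: two climbers on profiles
with a common minimum at the start and a common maximum at the end can reach the top at equal
heights. A surjective walk is first precomposed with a sweep over its domain, so that it starts at height `0`
and ends at height `n`; this gives `PathEpi.amalgamation`. Pulling back pending covers along
the sequence under construction yields a sequence of paths that factors through every cover of each
of its members (`exists_fraisse_sequence`). In its inverse limit every epimorphism lifts along every
morphism of paths, and a back-and-forth argument gives homogeneity (`threadProPath_homogeneous`).

Genericity. The orbit of `γ` is dense in `Homeo(P)^ι` as soon as `γ` lies in countably many sets
`approxSet ψ F u`: the tuples having a conjugate which, measured by `ψ`, is close to the given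
epimorphisms `u j` for `j` in the finite set `F`. These sets suffice because every homeomorphism of
`P` is approximated by automorphisms (`exists_aut_close`): it maps the chain of closed sets defined
by an epimorphism to another chain, and a fine epimorphism turns the comparison of the two chains
into a morphism of paths. The sets are open; the main point is that they are dense
(`dense_approxSet`). By refinement, tuples `γ` and `δ` of automorphisms are described up to
given precision by families of morphisms `F j : L_k → L_m` and `G j : L_l → L_m'`. An automorphism
tuple which agrees with `γ` exactly and has a conjugate agreeing with `δ` approximately is obtained
from `exists_zigzag_lift`. There a walker `a` on `L_k` runs up and down quickly, while `b` moves
slowly on `L_l`; all walks `F j ∘ a` are lifted to one long zigzag in `L_m`. Each pass of `a` takes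
every `F j ∘ a` through both turning points of the zigzag, where the lift may change to the next or
the previous monotone piece, independently for every `j`; hence the number of the piece can follow
`G j ∘ b`. Asking for agreement on one side only up to bounded error, which is all that density in
`Homeo(P)` requires, is what allows the indices `j` to change pieces at different times.
-/

namespace PreProj

/-! ### Strong homomorphisms between paths -/

theorem pathRel_iff {n : ℕ} {x y : Fin (n + 1)} :
    PathRel n x y ↔ (x : ℕ) ≤ y + 1 ∧ (y : ℕ) ≤ x + 1 := by
  simp only [PathRel, abs_le]; omega

/-- Discrete intermediate value theorem, locating an edge over which a walk crosses. -/
theorem exists_crossing {w : ℕ → ℤ} (hw : ∀ t, |w (t + 1) - w t| ≤ 1) {x y : ℕ} {b : ℤ}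
    (hx : w x ≤ b) (hy : b < w y) :
    ∃ t, (w t = b ∧ w (t + 1) = b + 1) ∨ (w (t + 1) = b ∧ w t = b + 1) := by
  by_contra! H
  have h1 : ∀ t, w t ≤ b ↔ w 0 ≤ b := by
    intro t
    induction t with
    | zero => rfl
    | succ t ih =>
      rw [← ih]
      have := hw t
      have := H t
      rw [abs_le] at *
      constructor <;> intro _ <;> by_contra _ <;> omega
  have := (h1 x).1 hx
  have := (h1 y).2 this
  omega

/-- The clamped extension to `ℤ` of a map between paths. -/
def pathExt {m n : ℕ} (f : Fin (m + 1) → Fin (n + 1)) (z : ℤ) : ℤ :=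
  ((f ⟨min z.toNat m, by omega⟩ : Fin (n + 1)) : ℕ)

@[simp] theorem pathExt_coe {m n : ℕ} (f : Fin (m + 1) → Fin (n + 1)) (i : Fin (m + 1)) :
    pathExt f ((i : ℕ) : ℤ) = ((f i : ℕ) : ℤ) := by
  have : (⟨min ((i : ℕ) : ℤ).toNat m, by omega⟩ : Fin (m + 1)) = i := by
    ext; simp only; omega
  rw [pathExt, this]

theorem pathExt_mem {m n : ℕ} (f : Fin (m + 1) → Fin (n + 1)) (z : ℤ) :
    0 ≤ pathExt f z ∧ pathExt f z ≤ n := by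
  unfold pathExt; omega

theorem pathExt_step {m n : ℕ} {f : Fin (m + 1) → Fin (n + 1)}
    (hf : ∀ x y, PathRel m x y → PathRel n (f x) (f y)) (x y : ℤ) (h : |x - y| ≤ 1) :
    |pathExt f x - pathExt f y| ≤ 1 := by
  refine hf _ _ ?_
  rw [pathRel_iff]
  rw [abs_le] at h
  simp only
  omega

/-- A map between paths is a strong homomorphism as soon as it takes adjacent vertices to adjacent
ones and attains both endpoints. -/
theorem mem_pathEpi {m n : ℕ} {f : Fin (m + 1) → Fin (n + 1)}
    (hf : ∀ x y, PathRel m x y → PathRel n (f x) (f y)) (h0 : ∃ x, (f x : ℕ) = 0)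
    (hn : ∃ x, (f x : ℕ) = n) : f ∈ PathEpi m n := by
  refine ⟨hf, ?_⟩
  obtain ⟨x₀, h0⟩ := h0
  obtain ⟨x₁, hn⟩ := hn
  have edge : ∀ b : ℕ, b < n → ∃ x y, (f x : ℕ) = b ∧ (f y : ℕ) = b + 1 ∧ PathRel m x y := by
    intro b hb
    obtain ⟨t, ht⟩ := exists_crossing (w := fun t : ℕ => pathExt f t) (b := b) (x := x₀) (y := x₁)
      (fun t => pathExt_step hf _ _ (by simp)) (by simp [h0]) (by simp [hn, hb])
    have hr : PathRel m ⟨min ((t : ℕ) : ℤ).toNat m, by omega⟩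
        ⟨min ((t + 1 : ℕ) : ℤ).toNat m, by omega⟩ := by
      rw [pathRel_iff]; simp only; omega
    simp only [pathExt] at ht
    rcases ht with ⟨h1, h2⟩ | ⟨h1, h2⟩
    · exact ⟨_, _, by exact_mod_cast h1, by exact_mod_cast h2, hr⟩
    · exact ⟨_, _, by exact_mod_cast h1, by exact_mod_cast h2, by
        rw [pathRel_iff] at hr ⊢; exact hr.symm⟩
  intro b₁ b₂ hb
  rw [pathRel_iff] at hb
  rcases lt_trichotomy b₁.1 b₂.1 with h | h | h
  · obtain ⟨x, y, h1, h2, h3⟩ := edge b₁ (by omega)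
    exact ⟨x, y, Fin.ext h1, Fin.ext (by omega), h3⟩
  · obtain rfl := Fin.ext h
    by_cases hb : b₁.1 < n
    · obtain ⟨x, y, h1, h2, h3⟩ := edge b₁ hb
      exact ⟨x, x, Fin.ext h1, Fin.ext h1, by simp [PathRel]⟩
    · exact ⟨x₁, x₁, Fin.ext (by omega), Fin.ext (by omega), by simp [PathRel]⟩
  · obtain ⟨x, y, h1, h2, h3⟩ := edge b₂ (by omega)
    exact ⟨y, x, Fin.ext (by omega), Fin.ext h1, by rw [pathRel_iff] at h3 ⊢; exact h3.symm⟩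

theorem PathEpi.surjective {m n : ℕ} {f : Fin (m + 1) → Fin (n + 1)} (hf : f ∈ PathEpi m n) :
    Function.Surjective f := fun b => by
  obtain ⟨x, _, h, _⟩ := hf.2 b b (by simp [PathRel])
  exact ⟨x, h⟩

theorem PathEpi.comp {l m n : ℕ} {f : Fin (m + 1) → Fin (n + 1)} {g : Fin (l + 1) → Fin (m + 1)}
    (hf : f ∈ PathEpi m n) (hg : g ∈ PathEpi l m) : f ∘ g ∈ PathEpi l n := by
  refine ⟨fun x y h => hf.1 _ _ (hg.1 _ _ h), fun b₁ b₂ h => ?_⟩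
  obtain ⟨c₁, c₂, rfl, rfl, h'⟩ := hf.2 _ _ h
  obtain ⟨d₁, d₂, rfl, rfl, h''⟩ := hg.2 _ _ h'
  exact ⟨d₁, d₂, rfl, rfl, h''⟩

theorem PathEpi.id (n : ℕ) : id ∈ PathEpi n n :=
  ⟨fun _ _ h => h, fun x y h => ⟨x, y, rfl, rfl, h⟩⟩

theorem PathEpi.to_zero {m : ℕ} (f : Fin (m + 1) → Fin (0 + 1)) : f ∈ PathEpi m 0 :=
  mem_pathEpi (fun x y _ => by rw [pathRel_iff]; omega) ⟨0, by omega⟩ ⟨0, by omega⟩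

/-- Strong homomorphisms between paths do not increase distances. -/
theorem PathEpi.dist_le {m n : ℕ} {f : Fin (m + 1) → Fin (n + 1)} (hf : f ∈ PathEpi m n) {N : ℕ}
    {x y : Fin (m + 1)} (h : |((x : ℕ) : ℤ) - (y : ℕ)| ≤ N) :
    |((f x : ℕ) : ℤ) - (f y : ℕ)| ≤ N := by
  induction N generalizing x y with
  | zero =>
    obtain rfl : x = y := Fin.ext (by rw [abs_le] at h; omega)
    simp
  | succ N ih =>
    obtain ⟨z, hz1, hz2⟩ : ∃ z : Fin (m + 1), |((x : ℕ) : ℤ) - (z : ℕ)| ≤ N ∧ PathRel m z y := by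
      simp only [pathRel_iff, abs_le] at *
      rcases lt_trichotomy x.1 y.1 with hh | hh | hh
      · exact ⟨⟨y - 1, by omega⟩, by simp only; omega⟩
      · exact ⟨y, by omega⟩
      · exact ⟨⟨y + 1, by omega⟩, by simp only; omega⟩
    have h1 := ih hz1
    have h2 := hf.1 _ _ hz2
    simp only [PathRel, abs_le] at *
    push_cast at *
    omega

/-- A walk in a path, given by integers, as a strong homomorphism. -/
theorem PathEpi.exists_of_walk {N n : ℕ} {w : ℕ → ℤ} (h : ∀ t ≤ N, 0 ≤ w t ∧ w t ≤ n)
    (hw : ∀ t < N, |w (t + 1) - w t| ≤ 1) (h0 : ∃ t ≤ N, w t = 0) (hn : ∃ t ≤ N, w t = n) :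
    ∃ f ∈ PathEpi N n, ∀ t : Fin (N + 1), ((f t : ℕ) : ℤ) = w t := by
  have key : ∀ t : Fin (N + 1), ((w t).toNat : ℤ) = w t ∧ (w t).toNat < n + 1 := fun t => by
    have := h t (by omega)
    omega
  refine ⟨fun t => ⟨(w t).toNat, (key t).2⟩, mem_pathEpi ?_ ?_ ?_, fun t => (key t).1⟩
  · intro x y hxy
    simp only [PathRel]
    rw [(key x).1, (key y).1]
    rw [pathRel_iff] at hxy
    rcases lt_trichotomy x.1 y.1 with hh | hh | hh
    · have := hw x (by omega)
      rw [show x.1 + 1 = y by omega, abs_sub_comm] at this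
      exact this
    · simp [hh]
    · have := hw y (by omega)
      rwa [show y.1 + 1 = x by omega] at this
  · obtain ⟨t, ht, h0⟩ := h0
    exact ⟨⟨t, by omega⟩, by simp [h0]⟩
  · obtain ⟨t, ht, h0⟩ := hn
    exact ⟨⟨t, by omega⟩, by simp [h0]⟩

/-! ### Climbing mountains, and amalgamation -/

/-- Two climbers at positions `s.1` and `s.2` of the profiles `f` and `g`, always at equal heights,
move by at most one step each. -/
def ClimbStep (f g : ℤ → ℤ) (s t : ℤ × ℤ) : Prop :=
  f s.1 = g s.2 ∧ f t.1 = g t.2 ∧ |t.1 - s.1| ≤ 1 ∧ |t.2 - s.2| ≤ 1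

theorem ClimbStep.symm {f g : ℤ → ℤ} {s t : ℤ × ℤ} (h : ClimbStep f g s t) : ClimbStep f g t s := by
  obtain ⟨h1, h2, h3, h4⟩ := h
  exact ⟨h2, h1, by rwa [abs_sub_comm], by rwa [abs_sub_comm]⟩

/-- The two climbers can get from the positions `s` to the positions `t`. -/
abbrev Climb (f g : ℤ → ℤ) : ℤ × ℤ → ℤ × ℤ → Prop := Relation.ReflTransGen (ClimbStep f g)

theorem Climb.symm {f g : ℤ → ℤ} {s t : ℤ × ℤ} (h : Climb f g s t) : Climb f g t s := by
  have : Std.Symm (ClimbStep f g) := ⟨fun _ _ h => h.symm⟩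
  exact Relation.ReflTransGen.stdSymm.symm _ _ h

theorem Climb.swap {f g : ℤ → ℤ} {s t : ℤ × ℤ} (h : Climb f g s t) : Climb g f s.swap t.swap :=
  Relation.ReflTransGen.lift (p := ClimbStep g f) Prod.swap
    (fun _ _ h => ⟨h.1.symm, h.2.1.symm, h.2.2.2, h.2.2.1⟩) _ _ h

/-- Reparametrizing both profiles by unit-speed maps of `ℤ`. -/
theorem Climb.map {f g : ℤ → ℤ} (u v : ℤ → ℤ) (hu : ∀ x y, |x - y| ≤ 1 → |u x - u y| ≤ 1)
    (hv : ∀ x y, |x - y| ≤ 1 → |v x - v y| ≤ 1) {s t : ℤ × ℤ} (h : Climb (f ∘ u) (g ∘ v) s t) :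
    Climb f g (u s.1, v s.2) (u t.1, v t.2) :=
  Relation.ReflTransGen.lift (p := ClimbStep f g) (fun s : ℤ × ℤ => (u s.1, v s.2))
    (fun _ _ h => ⟨h.1, h.2.1, hu _ _ h.2.2.1, hv _ _ h.2.2.2⟩) _ _ h

theorem climb_of_const {f g : ℤ → ℤ} {y : ℤ} (p : ℕ) (h : ∀ x : ℕ, x ≤ p → f x = g y) :
    Climb f g (0, y) (p, y) := by
  induction p with
  | zero => exact Relation.ReflTransGen.refl
  | succ p ih =>
    refine (ih fun x hx => h x (by omega)).tail
      ⟨h p (by omega), h (p + 1) le_rfl, by simp, by simp⟩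

/-- The mountain climbing lemma: two climbers on profiles which start at a common minimum and end
at a common maximum can reach the top while staying at equal heights. -/
theorem climb_of_le (N : ℕ) : ∀ (f g : ℤ → ℤ) (p q : ℕ), p + q ≤ N →
    (∀ z, |f (z + 1) - f z| ≤ 1) → (∀ z, |g (z + 1) - g z| ≤ 1) → f 0 = g 0 → f p = g q →
    (∀ x : ℕ, x ≤ p → f 0 ≤ f x ∧ f x ≤ f p) → (∀ y : ℕ, y ≤ q → g 0 ≤ g y ∧ g y ≤ g q) →
    Climb f g (0, 0) (p, q) := by
  induction N using Nat.strong_induction_on with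
  | _ N ih =>
  -- If `f` attains its maximum before `p`, climb there, and then make the excursion from the top
  -- down to the minimum of the rest of `f` and up again, the other climber going back and forth.
  have exc : ∀ (f g : ℤ → ℤ) (p q : ℕ), p + q ≤ N →
      (∀ z, |f (z + 1) - f z| ≤ 1) → (∀ z, |g (z + 1) - g z| ≤ 1) → f 0 = g 0 → f p = g q →
      (∀ x : ℕ, x ≤ p → f 0 ≤ f x ∧ f x ≤ f p) → (∀ y : ℕ, y ≤ q → g 0 ≤ g y ∧ g y ≤ g q) →
      f 0 ≠ f p → (∃ x : ℕ, x < p ∧ f x = f p) → Climb f g (0, 0) (p, q) := by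
    intro f g p q hN hf hg h0 h1 hfb hgb hne ⟨x, hxp, hx⟩
    have hx0 : 0 < x := by
      rcases Nat.eq_zero_or_pos x with rfl | h
      · exact absurd hx hne
      · exact h
    refine (ih (x + q) (by omega) f g x q le_rfl hf hg h0 (hx.trans h1)
      (fun z hz => hx ▸ hfb z (by omega)) hgb).trans ?_
    obtain ⟨b, hb, hbmin⟩ := Finset.exists_min_image (Finset.Icc x p) (fun z : ℕ => f z)
      ⟨x, by simp; omega⟩
    simp only [Finset.mem_Icc] at hb hbmin
    have hb' := hfb b hb.2
    obtain ⟨y, hy, hymax⟩ := Finset.exists_max_image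
      ((Finset.range (q + 1)).filter fun z : ℕ => g z ≤ f b) id
      ⟨0, by simp only [Finset.mem_filter, Finset.mem_range]; push_cast; omega⟩
    simp only [Finset.mem_filter, Finset.mem_range, id] at hy hymax
    have hyb : ∀ z : ℕ, y ≤ z → z ≤ q → f b ≤ g z := by
      intro z hyz hzq
      by_contra hlt
      have hz := hymax z ⟨by omega, by omega⟩
      obtain rfl : y = z := by omega
      by_cases hyq : y = q
      · subst hyq; omega
      · have h2 := hymax (y + 1)
        have h3 := hg y
        rw [abs_le] at h3
        push_cast at h2
        have := h2 ⟨by omega, by omega⟩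
        omega
    have hgy : g y = f b := le_antisymm hy.2 (hyb y le_rfl (by omega))
    have e1 : Climb f g (b, y) (x, q) := by
      have := Climb.map (f := f) (g := g) (fun z => b - z) (fun z => y + z)
        (fun s t h => by rw [abs_le] at *; omega) (fun s t h => by rw [abs_le] at *; omega)
        (ih ((b - x) + (q - y)) (by omega) (f ∘ fun z => b - z) (g ∘ fun z => y + z)
          (b - x) (q - y) le_rfl ?_ ?_ ?_ ?_ ?_ ?_)
      · have e1 : (b : ℤ) - ((b - x : ℕ) : ℤ) = x := by omega
        have e2 : (y : ℤ) + ((q - y : ℕ) : ℤ) = q := by omega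
        simpa [e1, e2] using this
      · intro z
        have := hf (b - z - 1)
        rw [abs_sub_comm] at this
        simp only [Function.comp_apply]
        convert this using 4 <;> ring
      · intro z
        have := hg (y + z)
        simp only [Function.comp_apply]
        convert this using 4; ring
      · simp [hgy]
      · have e1 : (b : ℤ) - ((b - x : ℕ) : ℤ) = x := by omega
        have e2 : (y : ℤ) + ((q - y : ℕ) : ℤ) = q := by omega
        simp only [Function.comp_apply, e1, e2]; omega
      · intro z hz
        have e1 : (b : ℤ) - ((b - x : ℕ) : ℤ) = x := by omega
        have e2 : (b : ℤ) - (z : ℤ) = ((b - z : ℕ) : ℤ) := by omega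
        simp only [Function.comp_apply, e1, e2, sub_zero]
        have := hbmin (b - z) (by omega)
        have := hfb (b - z) (by omega)
        omega
      · intro z hz
        have e1 : (y : ℤ) + ((q - y : ℕ) : ℤ) = q := by omega
        have e2 : (y : ℤ) + (z : ℤ) = ((y + z : ℕ) : ℤ) := by omega
        simp only [Function.comp_apply, e1, e2, add_zero]
        have := hyb (y + z) (by omega) (by omega)
        have := hgb (y + z) (by omega)
        omega
    have e2 : Climb f g (b, y) (p, q) := by
      have := Climb.map (f := f) (g := g) (fun z => b + z) (fun z => y + z)
        (fun s t h => by rw [abs_le] at *; omega) (fun s t h => by rw [abs_le] at *; omega)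
        (ih ((p - b) + (q - y)) (by omega) (f ∘ fun z => b + z) (g ∘ fun z => y + z)
          (p - b) (q - y) le_rfl ?_ ?_ ?_ ?_ ?_ ?_)
      · have e1 : (b : ℤ) + ((p - b : ℕ) : ℤ) = p := by omega
        have e2 : (y : ℤ) + ((q - y : ℕ) : ℤ) = q := by omega
        simpa [e1, e2] using this
      · intro z
        have := hf (b + z)
        simp only [Function.comp_apply]
        convert this using 4; ring
      · intro z
        have := hg (y + z)
        simp only [Function.comp_apply]
        convert this using 4; ring
      · simp [hgy]
      · have e1 : (b : ℤ) + ((p - b : ℕ) : ℤ) = p := by omega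
        have e2 : (y : ℤ) + ((q - y : ℕ) : ℤ) = q := by omega
        simp only [Function.comp_apply, e1, e2]; omega
      · intro z hz
        have e1 : (b : ℤ) + ((p - b : ℕ) : ℤ) = p := by omega
        have e2 : (b : ℤ) + (z : ℤ) = ((b + z : ℕ) : ℤ) := by omega
        simp only [Function.comp_apply, e1, e2, add_zero]
        have := hbmin (b + z) (by omega)
        have := hfb (b + z) (by omega)
        omega
      · intro z hz
        have e1 : (y : ℤ) + ((q - y : ℕ) : ℤ) = q := by omega
        have e2 : (y : ℤ) + (z : ℤ) = ((y + z : ℕ) : ℤ) := by omega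
        simp only [Function.comp_apply, e1, e2, add_zero]
        have := hyb (y + z) (by omega) (by omega)
        have := hgb (y + z) (by omega)
        omega
    exact e1.symm.trans e2
  intro f g p q hN hf hg h0 h1 hfb hgb
  by_cases hne : f 0 = f p
  · have hc1 := climb_of_const (f := f) (g := g) (y := 0) p fun x hx => by
      have := hfb x hx; omega
    have hc2 := climb_of_const (f := g) (g := f) (y := p) q fun y hy => by
      have := hgb y hy; omega
    exact hc1.trans hc2.swap
  by_cases hf1 : ∃ x : ℕ, x < p ∧ f x = f p
  · exact exc f g p q hN hf hg h0 h1 hfb hgb hne hf1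
  by_cases hg1 : ∃ y : ℕ, y < q ∧ g y = g q
  · exact (exc g f q p (by omega) hg hf h0.symm h1.symm hgb hfb (by omega) hg1).swap
  -- Otherwise the maximum is attained at the end only, and is reached by one common last step.
  push Not at hf1 hg1
  obtain ⟨p, rfl⟩ : ∃ p', p = p' + 1 := Nat.exists_eq_succ_of_ne_zero (by rintro rfl; simp at hne)
  obtain ⟨q, rfl⟩ : ∃ q', q = q' + 1 :=
    Nat.exists_eq_succ_of_ne_zero (by rintro rfl; push_cast at *; omega)
  have a1 := hf p
  have a2 := hg q
  have a3 := hf1 p (by omega)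
  have a4 := hg1 q (by omega)
  have a5 := hfb p (by omega)
  have a6 := hgb q (by omega)
  rw [abs_le] at a1 a2
  push_cast at *
  refine (ih (p + q) (by omega) f g p q le_rfl hf hg h0 (by omega) ?_ ?_).tail
    ⟨by simp only; omega, h1, by simp, by simp⟩
  · intro x hx
    have := hfb x (by omega)
    have := hf1 x (by omega)
    omega
  · intro x hx
    have := hgb x (by omega)
    have := hg1 x (by omega)
    omega

theorem exists_walk_of_reflTransGen {α : Type*} {r : α → α → Prop} {a b : α}
    (h : Relation.ReflTransGen r a b) :
    ∃ (N : ℕ) (w : ℕ → α), w 0 = a ∧ w N = b ∧ ∀ t < N, r (w t) (w (t + 1)) := by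
  induction h using Relation.ReflTransGen.head_induction_on with
  | refl => exact ⟨0, fun _ => b, rfl, rfl, by simp⟩
  | @head a c hac _ ih =>
    obtain ⟨N, w, h0, hN, hw⟩ := ih
    refine ⟨N + 1, fun t => t.casesOn a w, rfl, hN, ?_⟩
    rintro (_ | t) ht
    · simpa [h0] using hac
    · exact hw t (by omega)

/-- A walk of integers attains every value between its endpoints. -/
theorem exists_eq_of_walk {w : ℕ → ℤ} {N : ℕ} (hw : ∀ t < N, |w (t + 1) - w t| ≤ 1) {b : ℤ}
    (h0 : w 0 ≤ b) (hN : b ≤ w N) : ∃ t ≤ N, w t = b := by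
  induction N with
  | zero => exact ⟨0, le_rfl, le_antisymm h0 hN⟩
  | succ N ih =>
    by_cases h : b ≤ w N
    · obtain ⟨t, ht, h⟩ := ih (fun t ht => hw t (by omega)) h
      exact ⟨t, by omega, h⟩
    · refine ⟨N + 1, le_rfl, ?_⟩
      have := hw N (by omega)
      rw [abs_le] at this
      omega

/-- The walk `x₀, x₀ - 1, …, 0, 1, …, p, p - 1, p - 2, …`. -/
def sweep (p x₀ : ℕ) (t : ℤ) : ℤ := min |t - x₀| (2 * p + x₀ - t)

theorem sweep_step (p x₀ : ℕ) (s t : ℤ) (h : |s - t| ≤ 1) : |sweep p x₀ s - sweep p x₀ t| ≤ 1 := by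
  unfold sweep; grind

theorem pathExt_clamp {m n : ℕ} (f : Fin (m + 1) → Fin (n + 1)) (a : Fin (m + 1)) (z : ℤ)
    (h : ((a : ℕ) : ℤ) = max 0 (min (m : ℤ) z)) : pathExt f z = (f a : ℕ) := by
  have : (⟨min z.toNat m, by omega⟩ : Fin (m + 1)) = a := by ext; simp only; omega
  rw [pathExt, this]

/-- The walk of one climber, along the profile `pathExt f ∘ sweep p x₀`, as a strong
homomorphism. -/
theorem exists_pathEpi_of_sweep {p x₀ x₁ N : ℕ} (hx₁ : x₁ ≤ p) {w : ℕ → ℤ} (h0 : w 0 = 0)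
    (hN : w N = (2 * p + x₀ - x₁ : ℕ)) (hw : ∀ t < N, |w (t + 1) - w t| ≤ 1) :
    ∃ a ∈ PathEpi N p, ∀ t : Fin (N + 1),
      ((a t : ℕ) : ℤ) = max 0 (min (p : ℤ) (sweep p x₀ (w t))) := by
  refine PathEpi.exists_of_walk (w := fun t => max 0 (min (p : ℤ) (sweep p x₀ (w t)))) ?_ ?_ ?_ ?_
  · intro t _; omega
  · intro t ht
    have := sweep_step p x₀ _ _ (hw t ht)
    grind
  · obtain ⟨t, ht, h⟩ := exists_eq_of_walk hw (b := x₀) (by omega) (by omega)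
    refine ⟨t, ht, ?_⟩
    simp only [sweep, h, sub_self, abs_zero]
    omega
  · obtain ⟨t, ht, h⟩ := exists_eq_of_walk hw (b := x₀ + p) (by omega) (by omega)
    refine ⟨t, ht, ?_⟩
    simp only [sweep, h, add_sub_cancel_left, Nat.abs_cast]
    omega

/-- Amalgamation for the category of paths and strong homomorphisms. -/
theorem PathEpi.amalgamation {p q n : ℕ} {f : Fin (p + 1) → Fin (n + 1)}
    {g : Fin (q + 1) → Fin (n + 1)} (hf : f ∈ PathEpi p n) (hg : g ∈ PathEpi q n) :
    ∃ N, ∃ a ∈ PathEpi N p, ∃ b ∈ PathEpi N q, f ∘ a = g ∘ b := by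
  -- Precomposing with sweeps makes both profiles start at height `0` and end at height `n`.
  obtain ⟨x₀, hx₀⟩ := PathEpi.surjective hf 0
  obtain ⟨x₁, hx₁⟩ := PathEpi.surjective hf (Fin.last n)
  obtain ⟨y₀, hy₀⟩ := PathEpi.surjective hg 0
  obtain ⟨y₁, hy₁⟩ := PathEpi.surjective hg (Fin.last n)
  have start : ∀ {m : ℕ} (f : Fin (m + 1) → Fin (n + 1)) (x : Fin (m + 1)), f x = 0 →
      pathExt f (sweep m x 0) = 0 := by
    intro m f x h
    rw [pathExt_clamp f x _ (by unfold sweep; grind), h]; rfl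
  have fin : ∀ {m : ℕ} (f : Fin (m + 1) → Fin (n + 1)) (x y : Fin (m + 1)), f y = Fin.last n →
      pathExt f (sweep m x (2 * m + x - y : ℕ)) = n := by
    intro m f x y h
    rw [pathExt_clamp f y _ (by unfold sweep; grind), h]; rfl
  have hc := climb_of_le _ (pathExt f ∘ sweep p x₀) (pathExt g ∘ sweep q y₀) (2 * p + x₀ - x₁)
    (2 * q + y₀ - y₁) le_rfl
    (fun z => pathExt_step hf.1 _ _ (sweep_step _ _ _ _ (by simp)))
    (fun z => pathExt_step hg.1 _ _ (sweep_step _ _ _ _ (by simp)))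
    (by simp only [Function.comp_apply, start f x₀ hx₀, start g y₀ hy₀])
    (by simp only [Function.comp_apply, fin f x₀ x₁ hx₁, fin g y₀ y₁ hy₁])
    (fun x _ => by
      simp only [Function.comp_apply, start f x₀ hx₀, fin f x₀ x₁ hx₁]; exact pathExt_mem _ _)
    (fun x _ => by
      simp only [Function.comp_apply, start g y₀ hy₀, fin g y₀ y₁ hy₁]; exact pathExt_mem _ _)
  obtain ⟨N, w, h0, hN, hw⟩ := exists_walk_of_reflTransGen hc
  obtain ⟨a, ha, haw⟩ := exists_pathEpi_of_sweep (p := p) (x₀ := x₀) (x₁ := x₁) (N := N)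
    (by omega) (w := fun t => (w t).1) (by simp [h0]) (by simp [hN]) fun t ht => (hw t ht).2.2.1
  obtain ⟨b, hb, hbw⟩ := exists_pathEpi_of_sweep (p := q) (x₀ := y₀) (x₁ := y₁) (N := N)
    (by omega) (w := fun t => (w t).2) (by simp [h0]) (by simp [hN]) fun t ht => (hw t ht).2.2.2
  refine ⟨N, a, ha, b, hb, funext fun t => Fin.ext ?_⟩
  have heq : (pathExt f ∘ sweep p x₀) (w t).1 = (pathExt g ∘ sweep q y₀) (w t).2 := by
    rcases Nat.lt_or_ge t.1 N with h | h
    · exact (hw t h).1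
    · obtain h : t.1 = N := by omega
      rcases Nat.eq_zero_or_pos N with h' | h'
      · rw [h, h', h0]
        simp only [Function.comp_apply, start f x₀ hx₀, start g y₀ hy₀]
      · have := (hw (N - 1) (by omega)).2.1
        rwa [Nat.sub_add_cancel h', ← h] at this
  simp only [Function.comp_apply] at heq
  rw [pathExt_clamp f _ _ (haw t), pathExt_clamp g _ _ (hbw t)] at heq
  exact_mod_cast heq

/-! ### A Fraïssé sequence of paths -/

/-- A strong homomorphism from some path onto `L_n`. -/
abbrev Cover (n : ℕ) := Σ m, PathEpi m n

theorem Cover.exists_enum (n : ℕ) : ∃ e : ℕ → Cover n, Function.Surjective e :=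
  haveI : Nonempty (Cover n) := ⟨⟨n, _, PathEpi.id n⟩⟩
  exists_surjective_nat _

theorem Cover.exists_pull {n : ℕ} (g t : Cover n) :
    ∃ t' : Cover g.1, ∃ k ∈ PathEpi t'.1 t.1, g.2.1 ∘ t'.2.1 = t.2.1 ∘ k := by
  obtain ⟨N, a, ha, b, hb, h⟩ := PathEpi.amalgamation g.2.2 t.2.2
  exact ⟨⟨N, a, ha⟩, b, hb, h⟩

/-- An enumeration of all covers of `L_n`. -/
noncomputable def Cover.enum (n : ℕ) : ℕ → Cover n := (Cover.exists_enum n).choose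

/-- The cover `t` of `L_n` pulled back along `g`, by amalgamation. -/
noncomputable def Cover.pull {n : ℕ} (g t : Cover n) : Cover g.1 := (Cover.exists_pull g t).choose

/-- A path together with covers of it, arranged in rows, through which the sequence has yet to
factor. -/
abbrev Stage := Σ n, (ℕ → ℕ → Cover n)

/-- The cover which is dealt with after stage `s`. -/
def Stage.cover (S : Stage) (s : ℕ) : Cover S.1 := S.2 s.unpair.1 s.unpair.2

/-- The path following stage `s` is the domain of the cover dealt with. All covers waiting are
pulled back to it, and the covers of the new path itself are put into row `s + 1`. -/
noncomputable def Stage.next (S : Stage) (s : ℕ) : Stage :=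
  ⟨(S.cover s).1, fun i => if i = s + 1 then Cover.enum _ else fun e => (S.cover s).pull (S.2 i e)⟩

/-- The paths of the sequence, with the covers waiting to be dealt with. -/
noncomputable def stage : ℕ → Stage
  | 0 => ⟨0, fun _ => Cover.enum 0⟩
  | s + 1 => (stage s).next s

/-- The bonding maps of the sequence of paths. -/
noncomputable def bond (s : ℕ) : Fin ((stage (s + 1)).1 + 1) → Fin ((stage s).1 + 1) :=
  ((stage s).cover s).2.1

theorem bond_mem (s : ℕ) : bond s ∈ PathEpi (stage (s + 1)).1 (stage s).1 :=
  ((stage s).cover s).2.2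

theorem stage_row (s : ℕ) : (stage s).2 s = Cover.enum _ := by
  cases s with
  | zero => rfl
  | succ s => exact if_pos rfl

/-- The inverse limit of a sequence of paths. -/
abbrev Thread {n : ℕ → ℕ} (π : ∀ s, Fin (n (s + 1) + 1) → Fin (n s + 1)) :=
  {x : ∀ s, Fin (n s + 1) // ∀ s, π s (x (s + 1)) = x s}

/-- There is a Fraïssé sequence of paths: one that starts with `L_0` and eventually factors through
every cover of each of its members. -/
theorem exists_fraisse_sequence :
    ∃ (n : ℕ → ℕ) (π : ∀ s, Fin (n (s + 1) + 1) → Fin (n s + 1)), n 0 = 0 ∧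
      (∀ s, π s ∈ PathEpi (n (s + 1)) (n s)) ∧
      ∀ i m, ∀ g ∈ PathEpi m (n i), ∃ j, ∃ h ∈ PathEpi (n j) m,
        ∀ x : Thread π, x.1 i = g (h (x.1 j)) := by
  refine ⟨fun s => (stage s).1, bond, rfl, bond_mem, ?_⟩
  intro i m (g : Fin (m + 1) → Fin ((stage i).1 + 1)) hg
  obtain ⟨e, he⟩ := (Cover.exists_enum (stage i).1).choose_spec ⟨m, g, hg⟩
  -- The cover `g` is entry `(i, e)` of stage `i`; follow its pullbacks to the stage handling it.
  have main : ∀ s, i ≤ s → ∃ u ∈ PathEpi ((stage s).2 i e).1 m,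
      ∀ x : Thread (n := fun s => (stage s).1) bond,
        ∀ w, x.1 s = ((stage s).2 i e).2.1 w → x.1 i = g (u w) := by
    intro s hs
    induction s, hs using Nat.le_induction with
    | base =>
      have : (stage i).2 i e = ⟨m, g, hg⟩ := by rw [stage_row]; exact he
      rw [this]
      exact ⟨id, PathEpi.id m, fun x w h => h⟩
    | succ s hs ih =>
      obtain ⟨u, hu, h⟩ := ih
      have : (stage (s + 1)).2 i e = ((stage s).cover s).pull ((stage s).2 i e) := by
        change (if i = s + 1 then Cover.enum _ else _) e = _
        rw [if_neg (by omega)]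
      rw [this]
      obtain ⟨k, hk, hk'⟩ := (Cover.exists_pull ((stage s).cover s) ((stage s).2 i e)).choose_spec
      refine ⟨u ∘ k, PathEpi.comp hu hk, fun x w hw => h x (k w) ?_⟩
      rw [← x.2 s, hw]
      exact congrFun hk' w
  obtain ⟨u, hu, h⟩ := main (Nat.pair i e) (Nat.left_le_pair i e)
  have hc : (stage (Nat.pair i e)).cover (Nat.pair i e) = (stage (Nat.pair i e)).2 i e := by
    simp only [Stage.cover, Nat.unpair_pair]
  have hd : ∀ c : Cover (stage (Nat.pair i e)).1, c = (stage (Nat.pair i e)).2 i e →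
      ∃ u ∈ PathEpi c.1 m, ∀ x : Thread (n := fun s => (stage s).1) bond,
        ∀ w, x.1 (Nat.pair i e) = c.2.1 w → x.1 i = g (u w) := by
    rintro c rfl
    exact ⟨u, hu, h⟩
  obtain ⟨u, hu, h⟩ := hd _ hc
  exact ⟨Nat.pair i e + 1, u, hu, fun x => h x _ (x.2 _).symm⟩

/-! ### The limit of a Fraïssé sequence -/

section Limit

variable {n : ℕ → ℕ} {π : ∀ s, Fin (n (s + 1) + 1) → Fin (n s + 1)}

theorem isClosed_thread : IsClosed {x : ∀ s, Fin (n s + 1) | ∀ s, π s (x (s + 1)) = x s} := by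
  simp only [Set.ofPred_forall]
  exact isClosed_iInter fun s => isClosed_eq
    (continuous_of_discreteTopology.comp (continuous_apply _)) (continuous_apply _)

instance : CompactSpace (Thread π) := isCompact_iff_compactSpace.1 isClosed_thread.isCompact

theorem continuous_thread_apply (s : ℕ) : Continuous fun x : Thread π => x.1 s :=
  (continuous_apply s).comp continuous_subtype_val

/-- A sequence of vertices which is compatible with the bonding maps below `i` can be changed above
`i` to become a point of the inverse limit. -/
theorem exists_thread_of_partial (hπ : ∀ s, π s ∈ PathEpi (n (s + 1)) (n s)) (i : ℕ)
    (a : ∀ s, Fin (n s + 1)) (ha : ∀ s < i, π s (a (s + 1)) = a s) :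
    ∃ x : Thread π, x.1 i = a i := by
  classical
  choose sec hsec using fun s => PathEpi.surjective (hπ s)
  let y : ∀ s, Fin (n s + 1) := fun s => Nat.rec (motive := fun s => Fin (n s + 1)) (a 0)
    (fun s v => if π s (a (s + 1)) = v then a (s + 1) else sec s v) s
  have hy : ∀ s, y (s + 1) = if π s (a (s + 1)) = y s then a (s + 1) else sec s (y s) :=
    fun s => rfl
  refine ⟨⟨y, fun s => ?_⟩, ?_⟩
  · rw [hy]
    split_ifs with h
    · exact h
    · exact hsec _ _
  · have : ∀ s ≤ i, y s = a s := by
      intro s hs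
      induction s with
      | zero => rfl
      | succ s ih => rw [hy, if_pos]; rw [ih (by omega), ha s (by omega)]
    exact this i le_rfl

theorem exists_thread (hπ : ∀ s, π s ∈ PathEpi (n (s + 1)) (n s)) (i : ℕ) (v : Fin (n i + 1)) :
    ∃ x : Thread π, x.1 i = v := by
  suffices ∃ a : ∀ s, Fin (n s + 1), (∀ s < i, π s (a (s + 1)) = a s) ∧ a i = v by
    obtain ⟨a, ha, rfl⟩ := this
    exact exists_thread_of_partial hπ i a ha
  induction i with
  | zero =>
    exact ⟨Function.update (fun _ => 0) 0 v, by simp, by simp⟩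
  | succ i ih =>
    obtain ⟨a, ha, hv⟩ := ih (π i v)
    refine ⟨Function.update a (i + 1) v, fun s hs => ?_, by simp⟩
    rcases Nat.lt_succ_iff_lt_or_eq.1 hs with h | rfl
    · rw [Function.update_of_ne (by omega), Function.update_of_ne (by omega), ha s h]
    · rw [Function.update_self, Function.update_of_ne (by omega), hv]

theorem exists_bond (hπ : ∀ s, π s ∈ PathEpi (n (s + 1)) (n s)) {i j : ℕ} (h : i ≤ j) :
    ∃ t ∈ PathEpi (n j) (n i), ∀ x : Thread π, x.1 i = t (x.1 j) := by
  induction j, h using Nat.le_induction with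
  | base => exact ⟨id, PathEpi.id _, fun x => rfl⟩
  | succ j h ih =>
    obtain ⟨t, ht, hx⟩ := ih
    exact ⟨t ∘ π j, PathEpi.comp ht (hπ j), fun x => by simp [hx, x.2 j]⟩

/-- A continuous map from the inverse limit to a discrete space factors through a member of the
sequence. -/
theorem exists_factor {Y : Type} [TopologicalSpace Y] [DiscreteTopology Y]
    (hπ : ∀ s, π s ∈ PathEpi (n (s + 1)) (n s)) {ψ : Thread π → Y} (hψ : Continuous ψ) :
    ∃ i, ∃ f : Fin (n i + 1) → Y, ∀ x, ψ x = f (x.1 i) := by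
  have key : ∃ i, ∀ x y : Thread π, x.1 i = y.1 i → ψ x = ψ y := by
    by_contra! H
    have hcl : IsClosed {p : Thread π × Thread π | ψ p.1 ≠ ψ p.2} :=
      ((isOpen_discrete {q : Y × Y | q.1 = q.2}).preimage
        ((hψ.comp continuous_fst).prodMk (hψ.comp continuous_snd))).isClosed_compl
    obtain ⟨i, hi⟩ := hcl.isCompact.elim_directed_family_closed
      (fun i => {p : Thread π × Thread π | p.1.1 i = p.2.1 i})
      (fun i => isClosed_eq ((continuous_thread_apply i).comp continuous_fst)
        ((continuous_thread_apply i).comp continuous_snd))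
      (by
        ext ⟨x, y⟩
        simp only [Set.mem_inter_iff, Set.mem_ofPred_eq, Set.mem_iInter, Set.mem_empty_iff_false,
          iff_false, not_and]
        intro hne h
        exact hne (congrArg ψ (Subtype.ext (funext h))))
      (by
        intro i j
        refine ⟨max i j, fun p hp => ?_, fun p hp => ?_⟩ <;> simp only [Set.mem_ofPred_eq] at hp ⊢
        · obtain ⟨t, _, ht⟩ := exists_bond hπ (le_max_left i j)
          rw [ht, ht, hp]
        · obtain ⟨t, _, ht⟩ := exists_bond hπ (le_max_right i j)
          rw [ht, ht, hp])
    obtain ⟨x, y, h1, h2⟩ := H i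
    have : (x, y) ∈ (∅ : Set (Thread π × Thread π)) := by
      rw [← hi]
      exact ⟨h2, h1⟩
    exact this
  obtain ⟨i, hi⟩ := key
  choose s hs using exists_thread hπ i
  exact ⟨i, fun v => ψ (s v), fun x => hi _ _ (hs _).symm⟩

/-- The pro-object given by a sequence of paths. -/
def threadProPath (hπ : ∀ s, π s ∈ PathEpi (n (s + 1)) (n s)) : ProPath (Thread π) where
  Epi m := {φ | ∃ i, ∃ f ∈ PathEpi (n i) m, ∀ x, φ x = f (x.1 i)}
  continuous_of_mem := by
    rintro m φ ⟨i, f, hf, h⟩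
    obtain rfl := funext h
    exact continuous_of_discreteTopology.comp (continuous_thread_apply i)
  surjective_of_mem := by
    rintro m φ ⟨i, f, hf, h⟩ v
    obtain ⟨u, rfl⟩ := PathEpi.surjective hf v
    obtain ⟨x, rfl⟩ := exists_thread hπ i u
    exact ⟨x, h x⟩
  factor := by
    intro Y _ _ _ ψ hψ
    obtain ⟨i, f, h⟩ := exists_factor hπ hψ
    exact ⟨n i, fun x => x.1 i, ⟨i, id, PathEpi.id _, fun _ => rfl⟩, f, funext h⟩
  cofinal := by
    rintro m k φ ψ ⟨i, f, hf, h⟩ ⟨j, g, hg, h'⟩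
    obtain ⟨t, ht, hti⟩ := exists_bond hπ (le_max_left i j)
    obtain ⟨u, hu, huj⟩ := exists_bond hπ (le_max_right i j)
    refine ⟨n (max i j), fun x => x.1 _, ⟨max i j, id, PathEpi.id _, fun _ => rfl⟩,
      f ∘ t, PathEpi.comp hf ht, g ∘ u, PathEpi.comp hg hu, funext fun x => ?_, funext fun x => ?_⟩
    · rw [h, hti]; rfl
    · rw [h', huj]; rfl
  comp_mem := by
    rintro m k φ f ⟨i, g, hg, h⟩ hf
    exact ⟨i, f ∘ g, PathEpi.comp hf hg, fun x => by simp [h]⟩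

end Limit

/-! ### Homogeneity of the limit of a Fraïssé sequence -/

section Homogeneity

variable {X : Type*} [TopologicalSpace X]

/-- The extension property: every epimorphism lifts along every morphism of paths. -/
def ProPath.Extends (E : ProPath X) : Prop :=
  ∀ {m n : ℕ} {ξ : X → Fin (n + 1)} {g : Fin (m + 1) → Fin (n + 1)}, ξ ∈ E.Epi n →
    g ∈ PathEpi m n → ∃ ξ' ∈ E.Epi m, ξ = g ∘ ξ'

/-- Two epimorphisms onto the same path. -/
structure ProPath.EpiPair (E : ProPath X) where
  size : ℕ
  left : X → Fin (size + 1)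
  right : X → Fin (size + 1)
  left_mem : left ∈ E.Epi size
  right_mem : right ∈ E.Epi size

/-- One step of the back-and-forth: a pair of epimorphisms can be refined, by the same bonding map
on both sides, to a pair both members of which are finer than a given epimorphism. -/
theorem ProPath.EpiPair.exists_refinement {E : ProPath X} (hE : E.Extends) (P : E.EpiPair) {n : ℕ}
    {ρ : X → Fin (n + 1)} (hρ : ρ ∈ E.Epi n) :
    ∃ (Q : E.EpiPair) (t : Fin (Q.size + 1) → Fin (P.size + 1))
      (g h : Fin (Q.size + 1) → Fin (n + 1)),
      P.left = t ∘ Q.left ∧ P.right = t ∘ Q.right ∧ g ∈ PathEpi Q.size n ∧ ρ = g ∘ Q.left ∧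
      h ∈ PathEpi Q.size n ∧ ρ = h ∘ Q.right := by
  obtain ⟨k, χ, hχ, f, hf, g, hg, h1, h2⟩ := E.cofinal P.left_mem hρ
  obtain ⟨β, hβ, h3⟩ := hE P.right_mem hf
  obtain ⟨k', χ', hχ', f', hf', g', hg', h1', h2'⟩ := E.cofinal hβ hρ
  obtain ⟨α, hα, h3'⟩ := hE hχ hf'
  refine ⟨⟨k', α, χ', hα, hχ'⟩, f ∘ f', g ∘ f', g', ?_, ?_, PathEpi.comp hg hf', ?_,
    hg', h2'⟩
  · rw [h1, h3']; rfl
  · rw [h3, h1']; rfl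
  · rw [h2, h3']; rfl

/-- A map from `X` to itself, given by compatible sequences of maps to finite sets. -/
theorem exists_map_of_sequences [CompactSpace X] {m : ℕ → ℕ} {α β : ∀ k, X → Fin (m k + 1)}
    (t : ∀ k, Fin (m (k + 1) + 1) → Fin (m k + 1)) (hα : ∀ k, α k = t k ∘ α (k + 1))
    (hβ : ∀ k, β k = t k ∘ β (k + 1)) (hc : ∀ k, Continuous (β k))
    (hs : ∀ k, Function.Surjective (β k)) : ∃ σ : X → X, ∀ k x, β k (σ x) = α k x := by
  have : ∀ x, ∃ y, ∀ k, β k y = α k x := by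
    intro x
    have hcl : ∀ k, IsClosed {y | β k y = α k x} := fun k => isClosed_eq (hc k) continuous_const
    obtain ⟨y, hy⟩ := IsCompact.nonempty_iInter_of_sequence_nonempty_isCompact_isClosed
      (fun k => {y | β k y = α k x})
      (fun k y hy => by
        simp only [Set.mem_ofPred_eq] at hy ⊢
        rw [hβ, hα, Function.comp_apply, hy]; rfl)
      (fun k => hs k _) (hcl 0).isCompact hcl
    exact ⟨y, fun k => Set.mem_iInter.1 hy k⟩
  choose σ hσ using this
  exact ⟨σ, fun k x => hσ x k⟩

variable {n : ℕ → ℕ} {π : ∀ s, Fin (n (s + 1) + 1) → Fin (n s + 1)}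

/-- Back-and-forth: two epimorphisms onto the same path are refined alternately to two sequences
with the same bonding maps, both of which determine the points of the limit. -/
theorem threadProPath_homogeneous (hπ : ∀ s, π s ∈ PathEpi (n (s + 1)) (n s))
    (hE : (threadProPath hπ).Extends) {k : ℕ} {φ ψ : Thread π → Fin (k + 1)}
    (hφ : φ ∈ (threadProPath hπ).Epi k) (hψ : ψ ∈ (threadProPath hπ).Epi k) :
    ∃ σ ∈ (threadProPath hπ).Aut, φ = ψ ∘ σ := by
  set E := threadProPath hπ
  have hρ : ∀ s, (fun x : Thread π => x.1 s) ∈ E.Epi (n s) :=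
    fun s => ⟨s, id, PathEpi.id _, fun _ => rfl⟩
  choose next t gl gr hl hr hgl hl' hgr hr' using
    fun (s : ℕ) (P : E.EpiPair) => P.exists_refinement hE (hρ s)
  let P : ℕ → E.EpiPair := fun s => Nat.rec ⟨k, φ, ψ, hφ, hψ⟩ next s
  obtain ⟨σ, hσ⟩ := exists_map_of_sequences (m := fun s => (P s).size)
    (α := fun s => (P s).left) (β := fun s => (P s).right) (fun s => t s (P s))
    (fun s => hl s (P s)) (fun s => hr s (P s)) (fun s => E.continuous_of_mem (P s).right_mem)
    (fun s => E.surjective_of_mem (P s).right_mem)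
  obtain ⟨τ, hτ⟩ := exists_map_of_sequences (m := fun s => (P s).size)
    (α := fun s => (P s).right) (β := fun s => (P s).left) (fun s => t s (P s))
    (fun s => hr s (P s)) (fun s => hl s (P s)) (fun s => E.continuous_of_mem (P s).left_mem)
    (fun s => E.surjective_of_mem (P s).left_mem)
  have hσs : ∀ s x, (σ x).1 s = gr s (P s) ((P (s + 1)).left x) := by
    intro s x
    rw [← hσ (s + 1) x]
    exact congrFun (hr' s (P s)) (σ x)
  have hτs : ∀ s x, (τ x).1 s = gl s (P s) ((P (s + 1)).right x) := by
    intro s x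
    rw [← hτ (s + 1) x]
    exact congrFun (hl' s (P s)) (τ x)
  have hστ : ∀ x, σ (τ x) = x := by
    intro x
    refine Subtype.ext (funext fun s => ?_)
    rw [hσs]
    exact (congrArg (gr s (P s)) (hτ (s + 1) x)).trans (congrFun (hr' s (P s)) x).symm
  have hτσ : ∀ x, τ (σ x) = x := by
    intro x
    refine Subtype.ext (funext fun s => ?_)
    rw [hτs]
    exact (congrArg (gl s (P s)) (hσ (s + 1) x)).trans (congrFun (hl' s (P s)) x).symm
  have hcont : ∀ {σ : Thread π → Thread π}, (∀ s, Continuous fun x => (σ x).1 s) → Continuous σ :=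
    fun h => continuous_induced_rng.2 (continuous_pi h)
  let S : Thread π ≃ₜ Thread π :=
    { toFun := σ
      invFun := τ
      left_inv := hτσ
      right_inv := hστ
      continuous_toFun := hcont fun s => by
        simp only [hσs]
        exact continuous_of_discreteTopology.comp (E.continuous_of_mem (P (s + 1)).left_mem)
      continuous_invFun := hcont fun s => by
        simp only [hτs]
        exact continuous_of_discreteTopology.comp (E.continuous_of_mem (P (s + 1)).right_mem) }
  refine ⟨S, ⟨?_, ?_⟩, funext fun x => (hσ 0 x).symm⟩
  · rintro m ξ ⟨s, f, hf, h⟩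
    have : ξ ∘ S = (f ∘ gr s (P s)) ∘ (P (s + 1)).left :=
      funext fun x => (h (σ x)).trans (congrArg f (hσs s x))
    rw [this]
    exact E.comp_mem (P (s + 1)).left_mem (PathEpi.comp hf (hgr s (P s)))
  · rintro m ξ ⟨s, f, hf, h⟩
    have : ξ ∘ S.symm = (f ∘ gl s (P s)) ∘ (P (s + 1)).right :=
      funext fun x => (h (τ x)).trans (congrArg f (hτs s x))
    rw [this]
    exact E.comp_mem (P (s + 1)).right_mem (PathEpi.comp hf (hgl s (P s)))

end Homogeneity

/-- A projective Fraïssé limit of the finite linear graphs exists. -/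
theorem exists_isLimit :
    ∃ (X : Type) (_ : TopologicalSpace X), CompactSpace X ∧ TopologicalSpace.MetrizableSpace X ∧
      TotallyDisconnectedSpace X ∧ ∃ E : ProPath X, E.IsLimit := by
  obtain ⟨n, π, hn, hπ, hext⟩ := exists_fraisse_sequence
  have hE : (threadProPath hπ).Extends := by
    rintro m k ξ g ⟨i, f, hf, h⟩ hg
    obtain ⟨N, a, ha, b, hb, hab⟩ := PathEpi.amalgamation hf hg
    obtain ⟨j, u, hu, hx⟩ := hext i N a ha
    refine ⟨fun x => b (u (x.1 j)), ⟨j, b ∘ u, PathEpi.comp hb hu, fun _ => rfl⟩,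
      funext fun x => ?_⟩
    rw [h, hx]
    exact congrFun hab _
  have : ∀ s, SecondCountableTopology (Fin (n s + 1)) := fun s => inferInstance
  have : SecondCountableTopology (∀ s, Fin (n s + 1)) := inferInstance
  have : SecondCountableTopology (Thread π) := TopologicalSpace.Subtype.secondCountableTopology _
  refine ⟨Thread π, inferInstance, inferInstance,
    TopologicalSpace.metrizableSpace_of_t3_secondCountable _, inferInstance,
    threadProPath hπ, ?_, ?_⟩
  · intro m
    let c : Fin (n 0 + 1) → Fin (0 + 1) := fun _ => 0
    obtain ⟨ξ, hξ, -⟩ := hE (m := m) (n := 0) (ξ := fun x => c (x.1 0))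
      ⟨0, c, PathEpi.to_zero c, fun _ => rfl⟩ (PathEpi.to_zero fun _ => 0)
    exact ⟨ξ, hξ⟩
  · intro k φ hφ ψ hψ
    exact threadProPath_homogeneous hπ hE hφ hψ

/-! ### Following several walks at once along a zigzag -/

theorem succ_div_mod {T : ℕ} (hT : 0 < T) (t : ℕ) :
    ((t + 1) / T = t / T ∧ (t + 1) % T = t % T + 1) ∨
      (t % T + 1 = T ∧ (t + 1) / T = t / T + 1 ∧ (t + 1) % T = 0) := by
  have h1 := Nat.mod_lt t hT
  have h2 : t + 1 = T * (t / T) + (t % T + 1) := by rw [← add_assoc, Nat.div_add_mod]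
  rcases Nat.lt_or_ge (t % T + 1) T with h | h
  · left
    rw [h2, Nat.mul_add_div hT, Nat.mul_add_mod, Nat.div_eq_of_lt h, Nat.mod_eq_of_lt h]
    simp
  · right
    have h3 : t % T + 1 = T := by omega
    rw [h2, h3, Nat.mul_add_div hT, Nat.mul_add_mod, Nat.div_self hT, Nat.mod_self]
    simp

/-- The position on the zigzag `0, 1, …, m, m - 1, …, 0, 1, …` at which it attains the value `v` in
its `r`-th monotone piece. -/
def zigzagIdx (m r v : ℕ) : ℕ := r * m + if r % 2 = 0 then v else m - v

/-- The value of the zigzag `0, 1, …, m, m - 1, …, 0, 1, …` at position `s`. -/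
def zigzag (m s : ℕ) : ℕ := if s % (2 * m) ≤ m then s % (2 * m) else 2 * m - s % (2 * m)

theorem zigzag_idx {m r v : ℕ} (hm : 0 < m) (hv : v ≤ m) : zigzag m (zigzagIdx m r v) = v := by
  have h2 : r * m = 2 * m * (r / 2) + r % 2 * m := by
    conv_lhs => rw [← Nat.div_add_mod r 2]
    ring
  rcases Nat.mod_two_eq_zero_or_one r with h | h
  · have : zigzagIdx m r v = 2 * m * (r / 2) + v := by simp [zigzagIdx, h2, h]
    rw [zigzag, this, Nat.mul_add_mod, Nat.mod_eq_of_lt (by omega), if_pos hv]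
  · rcases Nat.eq_zero_or_pos v with rfl | h0
    · have : zigzagIdx m r 0 = 2 * m * (r / 2) + 2 * m := by simp [zigzagIdx, h2, h]; ring
      rw [zigzag, this, Nat.mul_add_mod, Nat.mod_self]; simp
    · have : zigzagIdx m r v = 2 * m * (r / 2) + (2 * m - v) := by
        simp only [zigzagIdx, h2, h, one_mul, one_ne_zero, if_false]; omega
      rw [zigzag, this, Nat.mul_add_mod, Nat.mod_eq_of_lt (by omega)]
      split_ifs <;> omega

theorem zigzagIdx_bounds {m r v : ℕ} (hv : v ≤ m) :
    r * m ≤ zigzagIdx m r v ∧ zigzagIdx m r v ≤ r * m + m := by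
  unfold zigzagIdx; split_ifs <;> omega

theorem zigzagIdx_step {m r v v' : ℕ} (hv : v ≤ m) (hv' : v' ≤ m)
    (h : v ≤ v' + 1 ∧ v' ≤ v + 1) :
    |(zigzagIdx m r v : ℤ) - zigzagIdx m r v'| ≤ 1 := by
  rw [abs_le]; unfold zigzagIdx; split_ifs <;> omega

/-- Consecutive pieces of the zigzag share a turning point. -/
theorem exists_zigzagIdx_eq {m r r' : ℕ} (h : r ≤ r' + 1 ∧ r' ≤ r + 1) :
    ∃ v, (v = 0 ∨ v = m) ∧ zigzagIdx m r v = zigzagIdx m r' v := by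
  have key : ∀ r, ∃ v, (v = 0 ∨ v = m) ∧ zigzagIdx m r v = zigzagIdx m (r + 1) v := by
    intro r
    rcases Nat.mod_two_eq_zero_or_one r with h | h
    · exact ⟨m, Or.inr rfl, by simp [zigzagIdx, h, show (r + 1) % 2 = 1 by omega]; ring⟩
    · exact ⟨0, Or.inl rfl, by simp [zigzagIdx, h, show (r + 1) % 2 = 0 by omega]; ring⟩
  rcases Nat.lt_trichotomy r r' with h1 | rfl | h1
  · obtain rfl : r' = r + 1 := by omega
    exact key r
  · exact ⟨0, Or.inl rfl, rfl⟩
  · obtain rfl : r = r' + 1 := by omega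
    obtain ⟨v, hv, h⟩ := key r'
    exact ⟨v, hv, h.symm⟩

theorem zigzag_pathEpi {m m' : ℕ} (hm : 0 < m) :
    ∃ c ∈ PathEpi (m' * m + m) m, ∀ s : Fin (m' * m + m + 1), (c s : ℕ) = zigzag m s := by
  obtain ⟨c, hc, h⟩ := PathEpi.exists_of_walk (N := m' * m + m) (n := m)
    (w := fun s => (zigzag m s : ℤ))
    (fun s _ => by
      have := Nat.mod_lt s (show 0 < 2 * m by omega)
      unfold zigzag; split_ifs <;> omega)
    (fun s _ => by
      have := Nat.mod_lt s (show 0 < 2 * m by omega)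
      rw [abs_le]
      unfold zigzag
      rcases succ_div_mod (show 0 < 2 * m by omega) s with ⟨_, h⟩ | ⟨h, _, h'⟩
      · rw [h]; split_ifs <;> omega
      · rw [h']; split_ifs <;> omega)
    ⟨0, by omega, by simp [zigzag]⟩
    ⟨m, by omega, by simp [zigzag, Nat.mod_eq_of_lt (show m < 2 * m by omega)]⟩
  exact ⟨c, hc, fun s => by exact_mod_cast h s⟩

/-- The position of the walker on `{0, …, k}` who goes up and down again, `2 * (k + 1)` being the
period. -/
def updown (k u : ℕ) : ℕ := if u ≤ k then u else 2 * k + 1 - u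

/-- Given two families of morphisms `F j : L_k → L_m` and `G j : L_l → L_m'`, the walker `a` on
`L_k` runs up and down quickly, while the walker `b` on `L_l` makes one step in each period of `a`.
All walks `F j ∘ a` lift simultaneously to a zigzag `c`, and, as each of them visits a turning point
of the zigzag in each pass of `a`, the lifts can be chosen so that the piece of the zigzag in which
they are follows the walk `G j ∘ b`. The number of the piece is recorded by `d`. -/
theorem exists_zigzag_lift {J : Type*} {k l m m' : ℕ} (hm : 0 < m)
    {F : J → Fin (k + 1) → Fin (m + 1)} {G : J → Fin (l + 1) → Fin (m' + 1)}
    (hF : ∀ j, F j ∈ PathEpi k m) (hG : ∀ j, G j ∈ PathEpi l m') :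
    ∃ N K, ∃ a ∈ PathEpi N k, ∃ b ∈ PathEpi N l, ∃ c ∈ PathEpi K m,
      ∃ (d : Fin (K + 1) → ℤ) (e : J → Fin (N + 1) → Fin (K + 1)), ∀ j, e j ∈ PathEpi N K ∧
        F j ∘ a = c ∘ e j ∧ ∀ t, |((G j (b t) : ℕ) : ℤ) - d (e j t)| ≤ 2 := by
  obtain ⟨c, hc, hcz⟩ := zigzag_pathEpi (m' := m') hm
  set T := 2 * (k + 1) with hTdef
  have hT : 0 < T := by omega
  set N := T * l + (2 * k + 1) with hN
  have hdiv : ∀ β u, u < T → (T * β + u) / T = β ∧ (T * β + u) % T = u := by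
    intro β u hu
    rw [Nat.mul_add_div hT, Nat.mul_add_mod, Nat.div_eq_of_lt hu, Nat.mod_eq_of_lt hu]
    simp
  have hle : ∀ β u, β ≤ l → u < T → T * β + u ≤ N := by
    intro β u hβ hu
    have := Nat.mul_le_mul_left T hβ
    omega
  have hlt : ∀ t ≤ N, t / T ≤ l := by
    intro t ht
    refine Nat.le_of_lt_succ ((Nat.div_lt_iff_lt_mul hT).2 ?_)
    rw [Nat.succ_mul, mul_comm l T]
    omega
  have hud : ∀ t, updown k (t % T) ≤ k := by
    intro t
    have := Nat.mod_lt t hT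
    unfold updown; split_ifs <;> omega
  have hudstep : ∀ t, updown k (t % T) ≤ updown k ((t + 1) % T) + 1 ∧
      updown k ((t + 1) % T) ≤ updown k (t % T) + 1 := by
    intro t
    have := Nat.mod_lt t hT
    unfold updown
    rcases succ_div_mod hT t with ⟨_, h⟩ | ⟨h, _, h'⟩
    · rw [h]; split_ifs <;> omega
    · rw [h']; split_ifs <;> omega
  obtain ⟨a, ha, haw⟩ := PathEpi.exists_of_walk (N := N) (n := k)
    (w := fun t => (updown k (t % T) : ℤ))
    (fun t _ => by have := hud t; omega)
    (fun t _ => by have := hudstep t; rw [abs_le]; omega)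
    ⟨0, by omega, by simp [updown]⟩
    ⟨k, by omega, by simp [updown, Nat.mod_eq_of_lt (show k < T by omega)]⟩
  obtain ⟨b, hb, hbw⟩ := PathEpi.exists_of_walk (N := N) (n := l) (w := fun t => ((t / T : ℕ) : ℤ))
    (fun t ht => ⟨Int.natCast_nonneg _, by exact_mod_cast hlt t ht⟩)
    (fun t _ => by
      rw [abs_le]
      rcases succ_div_mod hT t with ⟨h, _⟩ | ⟨_, h, _⟩ <;> rw [h] <;> omega)
    ⟨0, by omega, by simp⟩
    ⟨T * l + 0, hle l 0 le_rfl hT, by rw [(hdiv l 0 hT).1]⟩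
  replace haw : ∀ t, (a t : ℕ) = updown k (t % T) := fun t => by exact_mod_cast haw t
  replace hbw : ∀ t, (b t : ℕ) = t / T := fun t => by exact_mod_cast hbw t
  have lift : ∀ j, ∃ e ∈ PathEpi N (m' * m + m), F j ∘ a = c ∘ e ∧
      ∀ t, |((G j (b t) : ℕ) : ℤ) - ((e t : ℕ) / m : ℕ)| ≤ 2 := by
    intro j
    -- the piece of the zigzag aimed at
    let R : ℕ → ℕ := fun β => G j ⟨min β l, by omega⟩
    have hR : ∀ β, R β ≤ R (β + 1) + 1 ∧ R (β + 1) ≤ R β + 1 := fun β =>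
      pathRel_iff.1 ((hG j).1 _ _ (by rw [pathRel_iff]; simp only; omega))
    have hRm : ∀ β, R β ≤ m' := fun β => Nat.le_of_lt_succ (G j _).2
    let V : ℕ → ℕ := fun x => F j ⟨min x k, by omega⟩
    have hV : ∀ x y, x ≤ y + 1 ∧ y ≤ x + 1 → V x ≤ V y + 1 ∧ V y ≤ V x + 1 := fun x y h =>
      pathRel_iff.1 ((hF j).1 _ _ (by rw [pathRel_iff]; simp only; omega))
    have hVm : ∀ x, V x ≤ m := fun x => Nat.le_of_lt_succ (F j _).2
    have hVs : ∀ v ≤ m, ∃ x ≤ k, V x = v := by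
      intro v hv
      obtain ⟨x, hx⟩ := PathEpi.surjective (hF j) ⟨v, by omega⟩
      refine ⟨x, by omega, ?_⟩
      have : (⟨min x k, by omega⟩ : Fin (k + 1)) = x := by ext; simp only; omega
      simp only [V, this, hx]
    have hRs : ∀ v ≤ m', ∃ x ≤ l, R x = v := by
      intro v hv
      obtain ⟨x, hx⟩ := PathEpi.surjective (hG j) ⟨v, by omega⟩
      refine ⟨x, by omega, ?_⟩
      have : (⟨min x l, by omega⟩ : Fin (l + 1)) = x := by ext; simp only; omega
      simp only [R, this, hx]
    -- On the way down in period `β`, the lift changes to the new piece when `a` has reached `x β`.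
    have hx : ∀ β, ∃ x ≤ k, zigzagIdx m (R β) (V x) = zigzagIdx m (R (β + 1)) (V x) := by
      intro β
      obtain ⟨v, hv, h⟩ := exists_zigzagIdx_eq (m := m) (hR β)
      obtain ⟨x, hx, rfl⟩ := hVs v (by omega)
      exact ⟨x, hx, h⟩
    choose x hxk hx using hx
    let row : ℕ → ℕ → ℕ := fun β u => if u ≤ k ∨ x β ≤ updown k u then R β else R (β + 1)
    have hrowm : ∀ β u, row β u ≤ m' := by
      intro β u
      simp only [row]; split_ifs <;> apply hRm
    let w : ℕ → ℕ := fun t => zigzagIdx m (row (t / T) (t % T)) (V (updown k (t % T)))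
    have hidxK : ∀ r v, r ≤ m' → v ≤ m → zigzagIdx m r v ≤ m' * m + m := by
      intro r v hr hv
      have := (zigzagIdx_bounds (r := r) hv).2
      have := Nat.mul_le_mul_right m hr
      omega
    have hstep : ∀ t, |(w (t + 1) : ℤ) - w t| ≤ 1 := by
      intro t
      have hmod := Nat.mod_lt t hT
      have hus := hudstep t
      have same : ∀ r, |(zigzagIdx m r (V (updown k ((t + 1) % T))) : ℤ) -
          zigzagIdx m r (V (updown k (t % T)))| ≤ 1 := fun r =>
        zigzagIdx_step (hVm _) (hVm _) (hV _ _ ⟨by omega, by omega⟩)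
      -- It suffices that at time `t` the old and the new piece agree.
      suffices h : w t = zigzagIdx m (row ((t + 1) / T) ((t + 1) % T)) (V (updown k (t % T))) by
        rw [h]; exact same _
      simp only [w]
      rcases succ_div_mod hT t with ⟨h, h'⟩ | ⟨h, h', h''⟩
      · rw [h, h']
        simp only [row]
        by_cases h1 : t % T + 1 ≤ k
        · rw [if_pos (Or.inl h1), if_pos (Or.inl (by omega))]
        · by_cases h2 : x (t / T) ≤ updown k (t % T + 1)
          · rw [if_pos (Or.inr h2), if_pos]
            rcases Nat.lt_or_ge k (t % T) with h3 | h3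
            · right
              refine h2.trans ?_
              unfold updown; split_ifs <;> omega
            · exact Or.inl h3
          · rw [if_neg (not_or.2 ⟨h1, h2⟩)]
            split_ifs with h3
            · -- the moment of the change
              have : updown k (t % T) = x (t / T) := by
                have := hxk (t / T)
                unfold updown at *
                split_ifs at * <;> omega
              rw [this, hx]
            · rfl
      · rw [h', h'']
        simp only [row]
        rw [if_pos (Or.inl (Nat.zero_le k))]
        split_ifs with h3
        · have : updown k (t % T) = x (t / T) := by
            unfold updown at *
            split_ifs at * <;> omega
          rw [this, hx]
        · rfl
    have hfull : ∀ β u, u ≤ k → w (T * β + u) = zigzagIdx m (R β) (V u) := by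
      intro β u hu
      simp only [w, row]
      rw [(hdiv β u (by omega)).1, (hdiv β u (by omega)).2, if_pos (Or.inl hu)]
      simp [updown, hu]
    obtain ⟨e, he, hew⟩ := PathEpi.exists_of_walk (N := N) (n := m' * m + m)
      (w := fun t => (w t : ℤ))
      (fun t _ => ⟨by omega, by exact_mod_cast hidxK _ _ (hrowm _ _) (hVm _)⟩)
      (fun t _ => hstep t)
      (by
        obtain ⟨β, hβ, h1⟩ := hRs 0 (by omega)
        obtain ⟨u, hu, h2⟩ := hVs 0 (by omega)
        exact ⟨T * β + u, hle _ _ hβ (by omega), by rw [hfull β u hu, h1, h2]; simp [zigzagIdx]⟩)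
      (by
        obtain ⟨β, hβ, h1⟩ := hRs m' le_rfl
        obtain ⟨u, hu, h2⟩ := hVs (if m' % 2 = 0 then m else 0) (by split_ifs <;> omega)
        refine ⟨T * β + u, hle _ _ hβ (by omega), ?_⟩
        rw [hfull β u hu, h1, h2]
        unfold zigzagIdx
        split_ifs <;> simp)
    replace hew : ∀ t, (e t : ℕ) = w t := fun t => by exact_mod_cast hew t
    refine ⟨e, he, funext fun t => Fin.ext ?_, fun t => ?_⟩
    · simp only [Function.comp_apply]
      rw [hcz, hew, zigzag_idx hm (hVm _)]
      have : (⟨min (updown k (t % T)) k, by omega⟩ : Fin (k + 1)) = a t := by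
        ext; simp only; rw [haw]; have := hud t; omega
      simp only [V, this]
    · have h1 := zigzagIdx_bounds (m := m) (r := row (t / T) (t % T)) (hVm (updown k (t % T)))
      have h2 : row (t / T) (t % T) ≤ (e t : ℕ) / m := by
        rw [Nat.le_div_iff_mul_le hm, hew]; exact h1.1
      have h3 : (e t : ℕ) / m ≤ row (t / T) (t % T) + 1 := by
        rw [hew, ← Nat.lt_succ_iff, Nat.div_lt_iff_lt_mul hm]
        refine lt_of_le_of_lt h1.2 ?_
        rw [Nat.succ_eq_add_one, add_mul, add_mul]; omega
      have h4 : (G j (b t) : ℕ) = R (t / T) := by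
        have : (⟨min (t / T) l, by omega⟩ : Fin (l + 1)) = b t := by
          ext; simp only; rw [hbw]; have := hlt t (by omega); omega
        simp only [R, this]
      have h5 := hR (t / T)
      rw [h4, abs_le]
      simp only [row] at h2 h3
      split_ifs at h2 h3 <;> omega
  choose e he h1 h2 using lift
  exact ⟨N, _, a, ha, b, hb, c, hc, fun s => ((s : ℕ) / m : ℕ), e, fun j => ⟨he j, h1 j, h2 j⟩⟩

open Topology

/-! ### Epimorphisms as a measure of distance -/

/-- Two vertices of a path are at distance at most `N`. -/
def Close (N : ℕ) {n : ℕ} (a b : Fin (n + 1)) : Prop := |((a : ℕ) : ℤ) - (b : ℕ)| ≤ N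

theorem PathEpi.close {m n N : ℕ} {f : Fin (m + 1) → Fin (n + 1)} (hf : f ∈ PathEpi m n)
    {x y : Fin (m + 1)} (h : Close N x y) : Close N (f x) (f y) := PathEpi.dist_le hf h

theorem Close.trans {M N L n : ℕ} {a b c : Fin (n + 1)} (h : Close M a b) (h' : Close N b c)
    (hL : M + N ≤ L) : Close L a c := by
  unfold Close at *; rw [abs_le] at *; omega

theorem Close.symm {N n : ℕ} {a b : Fin (n + 1)} (h : Close N a b) : Close N b a := by
  unfold Close at *; rwa [abs_sub_comm]

theorem Close.mono {M N n : ℕ} {a b : Fin (n + 1)} (h : Close M a b) (hL : M ≤ N) :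
    Close N a b := by
  unfold Close at *; omega

theorem close_zero {n : ℕ} {a b : Fin (n + 1)} : Close 0 a b ↔ a = b := by
  rw [Close, Fin.ext_iff, abs_le]; push_cast; omega

namespace ProPath

variable {X : Type*} [TopologicalSpace X] {E : ProPath X}

theorem isClosed_close (E : ProPath X) {m : ℕ} {φ : X → Fin (m + 1)}
    (hφ : φ ∈ E.Epi m) (N : ℕ) : IsClosed {p : X × X | Close N (φ p.1) (φ p.2)} :=
  (isClosed_discrete {q : Fin (m + 1) × Fin (m + 1) | Close N q.1 q.2}).preimage
    (((E.continuous_of_mem hφ).comp continuous_fst).prodMk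
      ((E.continuous_of_mem hφ).comp continuous_snd))

theorem IsLimit.extends (hE : E.IsLimit) {m n : ℕ} {ξ : X → Fin (n + 1)}
    {g : Fin (m + 1) → Fin (n + 1)} (hξ : ξ ∈ E.Epi n) (hg : g ∈ PathEpi m n) :
    ∃ ξ' ∈ E.Epi m, ξ = g ∘ ξ' := by
  obtain ⟨θ, hθ⟩ := hE.universal m
  obtain ⟨σ, hσ, rfl⟩ := hE.homogeneous n ξ hξ _ (E.comp_mem hθ hg)
  exact ⟨θ ∘ σ, hσ.1 _ _ hθ, rfl⟩

theorem IsLimit.exists_halving (hE : E.IsLimit) {n : ℕ} {φ : X → Fin (n + 1)} (hφ : φ ∈ E.Epi n) :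
    ∃ ψ ∈ E.Epi (2 * n + 1), (∃ f ∈ PathEpi (2 * n + 1) n, φ = f ∘ ψ) ∧
      ∀ N x y, Close (2 * N) (ψ x) (ψ y) → Close N (φ x) (φ y) := by
  obtain ⟨ψ, hψ, rfl⟩ := hE.extends hφ (halving_mem n)
  refine ⟨ψ, hψ, ⟨_, halving_mem n, rfl⟩, fun N x y h => ?_⟩
  simp only [Close, abs_le, Function.comp_apply] at *
  push_cast at *
  omega

/-- Any bound on the distances yields the relation, since epimorphisms factor through finer ones. -/
theorem IsLimit.rel_of_forall_close (hE : E.IsLimit) {x y : X}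
    (h : ∀ n, ∀ φ ∈ E.Epi n, Close 8 (φ x) (φ y)) : E.Rel x y := by
  intro n φ hφ
  obtain ⟨ψ₁, hψ₁, -, h₁⟩ := hE.exists_halving hφ
  obtain ⟨ψ₂, hψ₂, -, h₂⟩ := hE.exists_halving hψ₁
  obtain ⟨ψ₃, hψ₃, -, h₃⟩ := hE.exists_halving hψ₂
  exact h₁ 1 x y (h₂ 2 x y (h₃ 4 x y (h _ ψ₃ hψ₃)))

theorem IsLimit.nonempty_epi (hE : E.IsLimit) : Nonempty (Σ m, E.Epi m) :=
  let ⟨φ, hφ⟩ := hE.universal 0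
  ⟨⟨0, φ, hφ⟩⟩

/-- By compactness, a closed set of pairs of points that can be separated by epimorphisms one by one
can be separated by a single one. -/
theorem IsLimit.exists_not_close [CompactSpace X] (hE : E.IsLimit) {N : ℕ} {C : Set (X × X)}
    (hC : IsClosed C) (h : ∀ p ∈ C, ∃ m, ∃ φ ∈ E.Epi m, ¬ Close N (φ p.1) (φ p.2)) :
    ∃ φ : Σ m, E.Epi m, ∀ x y, (x, y) ∈ C → ¬ Close N (φ.2.1 x) (φ.2.1 y) := by
  have := hE.nonempty_epi
  obtain ⟨φ, hφ⟩ := hC.isCompact.elim_directed_family_closed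
    (fun φ : Σ m, E.Epi m => {p : X × X | Close N (φ.2.1 p.1) (φ.2.1 p.2)})
    (fun φ => E.isClosed_close φ.2.2 N)
    (by
      rw [Set.eq_empty_iff_forall_notMem]
      rintro p ⟨hp, hp'⟩
      obtain ⟨m, φ, hφ, hn⟩ := h p hp
      exact hn (Set.mem_iInter.1 hp' ⟨m, φ, hφ⟩))
    (by
      rintro ⟨m, φ, hφ⟩ ⟨n, ψ, hψ⟩
      obtain ⟨k, χ, hχ, f, hf, g, hg, rfl, rfl⟩ := E.cofinal hφ hψ
      exact ⟨⟨k, χ, hχ⟩, fun p hp => PathEpi.close hf hp, fun p hp => PathEpi.close hg hp⟩)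
  refine ⟨φ, fun x y hp hc => ?_⟩
  have : (x, y) ∈ (∅ : Set (X × X)) := by
    rw [← hφ]
    exact ⟨hp, hc⟩
  exact this

theorem exists_ne [CompactSpace X] [T2Space X] [TotallyDisconnectedSpace X] {x y : X} (h : x ≠ y) :
    ∃ m, ∃ φ ∈ E.Epi m, φ x ≠ φ y := by
  obtain ⟨U, hU, hx, hy⟩ := exists_isClopen_of_totally_separated h
  classical
  obtain ⟨m, φ, hφ, f, hf⟩ := E.factor Bool (fun z => decide (z ∈ U))
    (by
      refine continuous_def.2 fun s _ => ?_
      have : (fun z => decide (z ∈ U)) ⁻¹' s =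
          {z | (z ∈ U ∧ true ∈ s) ∨ (z ∉ U ∧ false ∈ s)} := by
        ext z
        by_cases hz : z ∈ U <;> simp [hz]
      rw [this]
      by_cases h1 : true ∈ s <;> by_cases h2 : false ∈ s <;> simp only [h1, h2, and_true, and_false,
        or_false, false_or]
      · simp [em]
      · exact hU.isOpen
      · exact hU.compl.isOpen
      · simp)
  refine ⟨m, φ, hφ, fun he => ?_⟩
  have h1 := congrFun hf x
  have h2 := congrFun hf y
  simp only [Function.comp_apply, he] at h1 h2
  rw [← h2] at h1
  simp [hx] at h1
  exact hy h1

/-- Finitely many epimorphisms have a common refinement. -/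
theorem IsLimit.exists_common (hE : E.IsLimit) {J : Type*} [Finite J] {m : ℕ}
    {Φ : J → X → Fin (m + 1)} (hΦ : ∀ j, Φ j ∈ E.Epi m) :
    ∃ k, ∃ χ ∈ E.Epi k, ∃ F : J → Fin (k + 1) → Fin (m + 1),
      ∀ j, F j ∈ PathEpi k m ∧ Φ j = F j ∘ χ := by
  classical
  have := Fintype.ofFinite J
  have main : ∀ s : Finset J, ∃ k, ∃ χ ∈ E.Epi k, ∀ j ∈ s, ∃ f ∈ PathEpi k m, Φ j = f ∘ χ := by
    intro s
    induction s using Finset.induction_on with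
    | empty =>
      obtain ⟨χ, hχ⟩ := hE.universal 0
      exact ⟨0, χ, hχ, by simp⟩
    | insert j s _ ih =>
      obtain ⟨k, χ, hχ, h⟩ := ih
      obtain ⟨k', χ', hχ', f, hf, g, hg, h1, h2⟩ := E.cofinal hχ (hΦ j)
      refine ⟨k', χ', hχ', fun i hi => ?_⟩
      rcases Finset.mem_insert.1 hi with rfl | hi
      · exact ⟨g, hg, h2⟩
      · obtain ⟨u, hu, h3⟩ := h i hi
        exact ⟨u ∘ f, PathEpi.comp hu hf, by rw [h3, h1]; rfl⟩
  obtain ⟨k, χ, hχ, h⟩ := main Finset.univ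
  choose F hF hF' using fun j => h j (Finset.mem_univ j)
  exact ⟨k, χ, hχ, F, fun j => ⟨hF j, hF' j⟩⟩

/-! ### The quotient space and its homeomorphisms -/

theorem isClosed_rel (E : ProPath X) : IsClosed {p : X × X | E.Rel p.1 p.2} := by
  have : {p : X × X | E.Rel p.1 p.2} =
      ⋂ (n) (φ ∈ E.Epi n), {p : X × X | Close 1 (φ p.1) (φ p.2)} := by
    ext p
    simp only [Set.mem_iInter]
    rfl
  rw [this]
  exact isClosed_iInter fun n => isClosed_iInter fun φ => isClosed_iInter fun hφ =>
    E.isClosed_close hφ 1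

theorem quo_mk_eq (hE : E.IsLimit) {x y : X} :
    (Quotient.mk (E.setoid hE) x = Quotient.mk (E.setoid hE) y) ↔ E.Rel x y :=
  Quotient.eq

/-- The relation being closed, and `X` compact, the quotient is Hausdorff: classes are separated
by the open sets of points whose whole class has `φ`-values near a given vertex. -/
theorem t2Space_quo [CompactSpace X] (hE : E.IsLimit) : T2Space (E.Quo hE) := by
  refine ⟨?_⟩
  rintro ⟨x⟩ ⟨y⟩ hne
  have hxy : ¬ E.Rel x y := fun h => hne ((quo_mk_eq hE).2 h)
  obtain ⟨m, φ, hφ, hd⟩ : ∃ m, ∃ φ ∈ E.Epi m, ¬ Close 8 (φ x) (φ y) := by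
    by_contra! H
    exact hxy (hE.rel_of_forall_close H)
  -- the set of the points whose whole class is mapped by `φ` close to `v`
  let U : Fin (m + 1) → Set (E.Quo hE) := fun v =>
    {p | ∀ z, Quotient.mk (E.setoid hE) z = p → Close 1 (φ z) v}
  have hU : ∀ v, IsOpen (U v) := by
    intro v
    refine isQuotientMap_quot_mk.isOpen_preimage.1 ?_
    rw [← isClosed_compl_iff]
    have : (Quot.mk _ ⁻¹' U v)ᶜ =
        Prod.snd '' ({p : X × X | E.Rel p.1 p.2} ∩ {p | ¬ Close 1 (φ p.1) v}) := by
      ext w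
      simp only [Set.mem_image, Set.mem_inter_iff, Set.mem_ofPred_eq, Prod.exists, exists_eq_right]
      change (¬ ∀ z, Quotient.mk (E.setoid hE) z = Quotient.mk (E.setoid hE) w →
        Close 1 (φ z) v) ↔ _
      rw [not_forall]
      refine exists_congr fun z => ?_
      rw [Classical.not_imp]
      exact and_congr_left fun _ => quo_mk_eq hE
    rw [this]
    refine isClosedMap_snd_of_compactSpace _ ((E.isClosed_rel).inter ?_)
    exact (isClosed_discrete {w : Fin (m + 1) | ¬ Close 1 w v}).preimage
      ((E.continuous_of_mem hφ).comp continuous_fst)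
  refine ⟨U (φ x), U (φ y), hU _, hU _, fun z hz => ?_, fun z hz => ?_, ?_⟩
  · exact (quo_mk_eq hE).1 hz m φ hφ
  · exact (quo_mk_eq hE).1 hz m φ hφ
  · rw [Set.disjoint_left]
    rintro ⟨w⟩ h1 h2
    exact hd ((Close.trans (h1 w rfl).symm (h2 w rfl) le_rfl).mono (by omega))

/-- Two self-maps of the quotient are `ψ`-close if their values at every point have representatives
at `ψ`-distance at most `8`. The bound has to exceed the errors `1` of `exists_aut_close` and `4` of
`approxSet` together, and is a power of two for the sake of repeated halving. -/
def QuoClose (E : ProPath X) (hE : E.IsLimit) (ψ : Σ m, E.Epi m) (h h' : E.Quo hE ≃ₜ E.Quo hE) :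
    Prop :=
  ∀ p, ∃ x y, Quotient.mk (E.setoid hE) x = h p ∧ Quotient.mk (E.setoid hE) y = h' p ∧
    Close 8 (ψ.2.1 x) (ψ.2.1 y)

end ProPath

/-- A directed family of closeness relations which controls the values on compact sets yields
neighborhoods of tuples in powers of the compact-open topology. -/
theorem exists_of_mem_nhds_pi {ι I H Y : Type*} [Nonempty I] [TopologicalSpace H]
    [TopologicalSpace Y] {i : H → C(Y, Y)} (hi : IsInducing i) {P : I → H → H → Prop}
    (hdir : ∀ φ ψ, ∃ χ, ∀ a b, P χ a b → P φ a b ∧ P ψ a b)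
    (hP : ∀ a K O, IsCompact K → IsOpen O → Set.MapsTo (i a) K O →
      ∃ φ, ∀ b, P φ a b → Set.MapsTo (i b) K O)
    (h : ι → H) {U : Set (ι → H)} (hU : U ∈ 𝓝 h) :
    ∃ (F : Finset ι) (φ : I), ∀ h', (∀ j ∈ F, P φ (h j) (h' j)) → h' ∈ U := by
  classical
  let B : Finset ι × I → Set (ι → H) := fun q => {h' | ∀ j ∈ q.1, P q.2 (h j) (h' j)}
  have hB : Directed (· ≥ ·) fun q => Filter.principal (B q) := by
    rintro ⟨F, φ⟩ ⟨G, ψ⟩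
    obtain ⟨χ, hχ⟩ := hdir φ ψ
    refine ⟨(F ∪ G, χ), ?_, ?_⟩ <;> simp only [ge_iff_le, Filter.le_principal_iff,
      Filter.mem_principal] <;> intro h' hh j hj
    · exact (hχ _ _ (hh j (Finset.mem_union_left _ hj))).1
    · exact (hχ _ _ (hh j (Finset.mem_union_right _ hj))).2
  have ht : Filter.Tendsto id (⨅ q, Filter.principal (B q)) (𝓝 h) := by
    rw [tendsto_pi_nhds]
    intro j
    rw [hi.nhds_eq_comap, Filter.tendsto_comap_iff, ContinuousMap.tendsto_nhds_compactOpen]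
    intro K hK O hO hm
    obtain ⟨φ, hφ⟩ := hP _ K O hK hO hm
    refine Filter.mem_iInf_of_mem ({j}, φ) ?_
    intro h' hh
    exact hφ _ (hh j (Finset.mem_singleton_self j))
  obtain ⟨⟨F, φ⟩, hq⟩ := (Filter.mem_iInf_of_directed hB _).1 (ht hU)
  exact ⟨F, φ, fun h' hh => hq hh⟩

namespace ProPath

variable {X : Type*} [TopologicalSpace X] {E : ProPath X}

/-- Neighborhoods in powers of `Homeo(P)` in terms of epimorphisms of `X`. -/
theorem exists_quoClose [CompactSpace X] (hE : E.IsLimit) {ι : Type*}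
    (h : ι → (E.Quo hE ≃ₜ E.Quo hE)) {U : Set (ι → (E.Quo hE ≃ₜ E.Quo hE))} (hU : U ∈ 𝓝 h) :
    ∃ (F : Finset ι) (ψ : Σ m, E.Epi m),
      ∀ h', (∀ j ∈ F, E.QuoClose hE ψ (h j) (h' j)) → h' ∈ U := by
  have := hE.nonempty_epi
  have := t2Space_quo hE
  refine exists_of_mem_nhds_pi (i := fun h : E.Quo hE ≃ₜ E.Quo hE => ⟨h, h.continuous⟩) ⟨rfl⟩
    ?_ ?_ h hU
  · rintro ⟨m, φ, hφ⟩ ⟨n, ψ, hψ⟩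
    obtain ⟨k, χ, hχ, f, hf, g, hg, rfl, rfl⟩ := E.cofinal hφ hψ
    refine ⟨⟨k, χ, hχ⟩, fun a b hab => ⟨fun p => ?_, fun p => ?_⟩⟩
    · obtain ⟨x, y, hx, hy, hxy⟩ := hab p
      exact ⟨x, y, hx, hy, PathEpi.close hf hxy⟩
    · obtain ⟨x, y, hx, hy, hxy⟩ := hab p
      exact ⟨x, y, hx, hy, PathEpi.close hg hxy⟩
  · intro a K O hK hO hm
    have hmk : Continuous (Quotient.mk (E.setoid hE)) := continuous_quotient_mk'
    obtain ⟨ψ, hψ⟩ := hE.exists_not_close (N := 8)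
      (C := (Quotient.mk (E.setoid hE) ⁻¹' (a '' K)) ×ˢ (Quotient.mk (E.setoid hE) ⁻¹' Oᶜ))
      (((hK.image a.continuous).isClosed.preimage hmk).prod (hO.isClosed_compl.preimage hmk))
      (by
        rintro ⟨x, y⟩ ⟨⟨p, hp, hpx⟩, hy⟩
        by_contra! H
        have hxy := (quo_mk_eq hE).2 (hE.rel_of_forall_close H)
        refine hy ?_
        change Quotient.mk (E.setoid hE) y ∈ O
        rw [← hxy, ← hpx]
        exact hm hp)
    refine ⟨ψ, fun b hb p hp => ?_⟩
    obtain ⟨x, y, hx, hy, hxy⟩ := hb p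
    by_contra hO'
    exact hψ x y ⟨⟨p, hp, hx.symm⟩, fun hyO => hO' (hy ▸ hyO)⟩ hxy

/-- Neighborhoods in powers of `Aut(X)` in terms of epimorphisms of `X`. -/
theorem exists_epi_of_mem_nhds [CompactSpace X] [T2Space X] [TotallyDisconnectedSpace X]
    (hE : E.IsLimit) {ι : Type*} (γ : ι → E.Aut) {V : Set (ι → E.Aut)} (hV : V ∈ 𝓝 γ) :
    ∃ (F : Finset ι) (φ : Σ m, E.Epi m),
      ∀ γ' : ι → E.Aut, (∀ j ∈ F, φ.2.1 ∘ (γ' j).1 = φ.2.1 ∘ (γ j).1) → γ' ∈ V := by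
  have := hE.nonempty_epi
  have hi : IsInducing fun σ : X ≃ₜ X => (⟨σ, σ.continuous⟩ : C(X, X)) := ⟨rfl⟩
  refine exists_of_mem_nhds_pi (hi.comp IsInducing.subtypeVal)
    (P := fun (φ : Σ m, E.Epi m) (a b : E.Aut) => φ.2.1 ∘ b.1 = φ.2.1 ∘ a.1) ?_ ?_ γ hV
  · rintro ⟨m, φ, hφ⟩ ⟨n, ψ, hψ⟩
    obtain ⟨k, χ, hχ, f, hf, g, hg, rfl, rfl⟩ := E.cofinal hφ hψ
    refine ⟨⟨k, χ, hχ⟩, fun a b hab => ⟨?_, ?_⟩⟩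
    · exact congrArg (f ∘ ·) hab
    · exact congrArg (g ∘ ·) hab
  · intro a K O hK hO hm
    obtain ⟨φ, hφ⟩ := hE.exists_not_close (N := 0) (C := (a.1 '' K) ×ˢ Oᶜ)
      ((hK.image a.1.continuous).isClosed.prod hO.isClosed_compl)
      (by
        rintro ⟨x, y⟩ ⟨⟨z, hz, hzx⟩, hy⟩
        simp only [close_zero]
        refine exists_ne (E := E) ?_
        rintro rfl
        refine hy ?_
        change x ∈ O
        rw [← show a.1 z = x from hzx]
        exact hm hz)
    refine ⟨φ, fun b hb z hz => ?_⟩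
    by_contra hO'
    exact hφ (a.1 z) (b.1 z) ⟨⟨z, hz, rfl⟩, hO'⟩ (close_zero.2 (congrFun hb z).symm)

/-- Every homeomorphism `h` of the quotient is approximated by an automorphism. The sets of the
points of `X` which `h` takes to the links of the chain given by `ψ` form a chain again; sending a
vertex of a fine path to a link that its fibre meets is a morphism, and homogeneity turns it into
`δ`. -/
theorem exists_aut_close [CompactSpace X] (hE : E.IsLimit) (h : E.Quo hE ≃ₜ E.Quo hE) {m : ℕ}
    {ψ : X → Fin (m + 1)} (hψ : ψ ∈ E.Epi m) :
    ∃ δ ∈ E.Aut, ∀ x, ∃ z, Quotient.mk (E.setoid hE) z = h (Quotient.mk (E.setoid hE) x) ∧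
      Close 1 (ψ z) (ψ (δ x)) := by
  have := t2Space_quo hE
  have hmk : Continuous (Quotient.mk (E.setoid hE)) := continuous_quotient_mk'
  have hlift : ∀ x, ∃ z, Quotient.mk (E.setoid hE) z = h (Quotient.mk (E.setoid hE) x) :=
    fun x => Quotient.exists_rep _
  by_cases hm : m < 2
  · refine ⟨1, E.Aut.one_mem, fun x => ?_⟩
    obtain ⟨z, hz⟩ := hlift x
    exact ⟨z, hz, by rw [Close, abs_le]; omega⟩
  -- `D i` is the preimage in `X` under `h` of the `i`-th link of the chain given by `ψ`
  let D : Fin (m + 1) → Set X := fun i =>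
    {x | ∃ z, Quotient.mk (E.setoid hE) z = h (Quotient.mk (E.setoid hE) x) ∧ ψ z = i}
  have hD : ∀ i, IsClosed (D i) := by
    intro i
    have hc : IsClosed (ψ ⁻¹' {i}) :=
      (isClosed_discrete _).preimage (E.continuous_of_mem hψ)
    have := ((hc.isCompact.image hmk).isClosed.preimage h.continuous).preimage hmk
    convert this using 1
    ext x
    simp only [D, Set.mem_ofPred_eq, Set.mem_preimage, Set.mem_image, Set.mem_singleton_iff]
    exact exists_congr fun z => and_comm
  have hDrel : ∀ {i j x y}, x ∈ D i → y ∈ D j → E.Rel x y → Close 1 i j := by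
    rintro i j x y ⟨z, hz, rfl⟩ ⟨w, hw, rfl⟩ hxy
    rw [(quo_mk_eq hE).2 hxy, ← hw] at hz
    exact (quo_mk_eq hE).1 hz m ψ hψ
  obtain ⟨⟨M, θ, hθ⟩, hsep⟩ := hE.exists_not_close (N := 8)
    (C := ⋃ q : {q : Fin (m + 1) × Fin (m + 1) // ¬ Close 1 q.1 q.2}, D q.1.1 ×ˢ D q.1.2)
    (isClosed_iUnion_of_finite fun q => (hD _).prod (hD _))
    (by
      rintro ⟨x, y⟩ hxy
      obtain ⟨q, hx, hy⟩ := Set.mem_iUnion.1 hxy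
      by_contra! H
      exact q.2 (hDrel hx hy (hE.rel_of_forall_close H)))
  have hnear : ∀ {i j x y}, x ∈ D i → y ∈ D j → Close 1 (θ x) (θ y) → Close 1 i j := by
    intro i j x y hx hy hxy
    by_contra hij
    exact hsep x y (Set.mem_iUnion.2 ⟨⟨(i, j), hij⟩, hx, hy⟩) (hxy.mono (by omega))
  have hex : ∀ i, ∃ x, x ∈ D i := by
    intro i
    obtain ⟨z, hz⟩ := E.surjective_of_mem hψ i
    obtain ⟨x, hx⟩ := Quotient.exists_rep (h.symm (Quotient.mk (E.setoid hE) z))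
    exact ⟨x, z, by rw [hx, h.apply_symm_apply], hz⟩
  -- the induced map on the path, taking extreme values where possible
  have hG : ∀ s, ∃ i, (∃ x ∈ D i, θ x = s) ∧ ((∃ x ∈ D 0, θ x = s) → i = 0) ∧
      ((∃ x ∈ D (Fin.last m), θ x = s) → i = Fin.last m) := by
    intro s
    by_cases h0 : ∃ x ∈ D 0, θ x = s
    · refine ⟨0, h0, fun _ => rfl, fun h1 => ?_⟩
      obtain ⟨x, hx, hxs⟩ := h0
      obtain ⟨y, hy, rfl⟩ := h1
      have := hnear hx hy (by simp [Close, hxs])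
      rw [Close, abs_le] at this
      simp at this
      omega
    by_cases h1 : ∃ x ∈ D (Fin.last m), θ x = s
    · exact ⟨_, h1, fun h => absurd h h0, fun _ => rfl⟩
    · obtain ⟨x, hx⟩ := E.surjective_of_mem hθ s
      obtain ⟨z, hz⟩ := hlift x
      exact ⟨ψ z, ⟨x, ⟨z, hz, rfl⟩, hx⟩, fun h => absurd h h0, fun h => absurd h h1⟩
  choose G hGD hG0 hG1 using hG
  have hGepi : G ∈ PathEpi M m := by
    refine mem_pathEpi (fun s t hst => ?_) ?_ ?_
    · obtain ⟨x, hx, rfl⟩ := hGD s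
      obtain ⟨y, hy, rfl⟩ := hGD t
      exact hnear hx hy hst
    · obtain ⟨x, hx⟩ := hex 0
      exact ⟨θ x, by rw [hG0 _ ⟨x, hx, rfl⟩]; rfl⟩
    · obtain ⟨x, hx⟩ := hex (Fin.last m)
      exact ⟨θ x, by rw [hG1 _ ⟨x, hx, rfl⟩]; rfl⟩
  obtain ⟨δ, hδ, hδe⟩ := hE.homogeneous m _ (E.comp_mem hθ hGepi) ψ hψ
  refine ⟨δ, hδ, fun x => ?_⟩
  obtain ⟨z, hz⟩ := hlift x
  refine ⟨z, hz, ?_⟩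
  have h1 : ψ (δ x) = G (θ x) := (congrFun hδe x).symm
  rw [h1]
  obtain ⟨y, hy, hyx⟩ := hGD (θ x)
  exact hnear (x := x) (y := y) ⟨z, hz, rfl⟩ hy (by simp [Close, hyx])

end ProPath

namespace ProPath

/-! ### Generic tuples -/

variable {X : Type*} [TopologicalSpace X] {E : ProPath X}

theorem countable_epi [CompactSpace X] [TopologicalSpace.MetrizableSpace X]
    [TotallyDisconnectedSpace X] (E : ProPath X) (m : ℕ) : Countable (E.Epi m) := by
  let := TopologicalSpace.metrizableSpaceMetric X
  have : Countable (TopologicalSpace.Clopens X) :=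
    TopologicalSpace.Clopens.countable_iff_secondCountable.2 inferInstance
  let f : E.Epi m → Fin (m + 1) → TopologicalSpace.Clopens X := fun φ v =>
    ⟨φ.1 ⁻¹' {v}, (isClopen_discrete {v}).preimage (E.continuous_of_mem φ.2)⟩
  refine Function.Injective.countable (f := f) fun φ ψ h => Subtype.ext (funext fun x => ?_)
  have h1 : x ∈ (f φ (φ.1 x) : Set X) := rfl
  rw [h] at h1
  exact (show ψ.1 x = φ.1 x from h1).symm

theorem discreteTopology_continuousMap [CompactSpace X] (m : ℕ) :
    DiscreteTopology C(X, Fin (m + 1)) := by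
  refine discreteTopology_iff_isOpen_singleton.2 fun f => ?_
  have : {f} = ⋂ v, {g : C(X, Fin (m + 1)) | Set.MapsTo g (f ⁻¹' {v}) {v}} := by
    ext g
    simp only [Set.mem_singleton_iff, Set.mem_iInter]
    constructor
    · rintro rfl v x hx
      exact hx
    · intro h
      ext x : 1
      exact h (f x) rfl
  rw [this]
  exact isOpen_iInter_of_finite fun v => ContinuousMap.isOpen_setOfPred_mapsTo
    ((isClosed_discrete {v}).preimage f.continuous).isCompact (isOpen_discrete _)

/-- The tuples of automorphisms which have a conjugate that, measured by `ψ`, is close to `u` on the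
finite set `F` of indices. -/
def approxSet (E : ProPath X) {ι : Type*} {m : ℕ} (ψ : X → Fin (m + 1)) (F : Finset ι)
    (u : F → X → Fin (m + 1)) : Set (ι → E.Aut) :=
  {γ | ∃ g : E.Aut, ∀ j : F, ∀ x, Close 4 (ψ ((g * γ j * g⁻¹ : E.Aut).1 x)) (u j x)}

theorem isOpen_approxSet [CompactSpace X] {ι : Type*} {m : ℕ} {ψ : X → Fin (m + 1)}
    (hψ : ψ ∈ E.Epi m) (F : Finset ι) (u : F → X → Fin (m + 1)) :
    IsOpen (E.approxSet ψ F u) := by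
  have := discreteTopology_continuousMap (X := X) m
  have : E.approxSet ψ F u = ⋃ g : E.Aut, ⋂ j : F,
      {γ : ι → E.Aut | ∀ x, Close 4 (ψ ((g * γ j * g⁻¹ : E.Aut).1 x)) (u j x)} := by
    ext γ
    simp [approxSet]
  rw [this]
  refine isOpen_iUnion fun g => isOpen_iInter_of_finite fun j => ?_
  let T : E.Aut → C(X, Fin (m + 1)) := fun τ =>
    (ContinuousMap.comp ⟨ψ ∘ g.1, (E.continuous_of_mem hψ).comp g.1.continuous⟩
      ⟨τ.1, τ.1.continuous⟩).comp ⟨g.1.symm, g.1.symm.continuous⟩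
  have hC : Continuous fun τ : E.Aut => (⟨τ.1, τ.1.continuous⟩ : C(X, X)) :=
    (continuous_induced_dom (f := fun h : X ≃ₜ X => (⟨h, h.continuous⟩ : C(X, X)))).comp
      continuous_subtype_val
  have hT : Continuous T :=
    (ContinuousMap.continuous_precomp _).comp ((ContinuousMap.continuous_postcomp _).comp hC)
  exact (isOpen_discrete {f : C(X, Fin (m + 1)) | ∀ x, Close 4 (f x) (u j x)}).preimage
    (hT.comp (continuous_apply (j : ι)))

/-- Density: the zigzag lift provides automorphisms which approximate one tuple exactly and, after
conjugation, the other one up to bounded error. -/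
theorem dense_approxSet [CompactSpace X] [T2Space X] [TotallyDisconnectedSpace X]
    (hE : E.IsLimit) {ι : Type*} {m : ℕ} {ψ : X → Fin (m + 1)} (hψ : ψ ∈ E.Epi m) (F : Finset ι)
    {u : F → X → Fin (m + 1)} (hu : ∀ j, u j ∈ E.Epi m) : Dense (E.approxSet ψ F u) := by
  classical
  rw [dense_iff_inter_open]
  rintro V hV ⟨γ, hγ⟩
  obtain ⟨F', ⟨m₀, φ₀, hφ₀⟩, hγV⟩ := exists_epi_of_mem_nhds hE γ (hV.mem_nhds hγ)
  -- the zigzag needs a path with more than one vertex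
  obtain ⟨φ, hφ, ⟨f₀, -, hf₀⟩, -⟩ := hE.exists_halving hφ₀
  let S := F ∪ F'
  -- Both tuples, together with the identity, are described by morphisms between paths.
  let Φ : Option S → X → Fin (2 * m₀ + 1 + 1) := fun o => o.elim φ fun j => φ ∘ (γ j).1
  let Ψ : Option S → X → Fin (m + 1) := fun o =>
    o.elim ψ fun j => if h : (j : ι) ∈ F then u ⟨j, h⟩ else ψ
  have hΦ : ∀ o, Φ o ∈ E.Epi (2 * m₀ + 1) := by
    rintro (_ | j)
    · exact hφ
    · exact (γ j).2.1 _ _ hφ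
  have hΨ : ∀ o, Ψ o ∈ E.Epi m := by
    rintro (_ | j)
    · exact hψ
    · simp only [Ψ, Option.elim]
      split_ifs
      · exact hu _
      · exact hψ
  obtain ⟨k, χ, hχ, P, hP⟩ := hE.exists_common hΦ
  obtain ⟨l, χ', hχ', Q, hQ⟩ := hE.exists_common hΨ
  obtain ⟨N, K, a, ha, b, hb, c, hc, d, e, he⟩ :=
    exists_zigzag_lift (by omega) (fun o => (hP o).1) (fun o => (hQ o).1)
  obtain ⟨η, hη, hηχ⟩ := hE.extends hχ ha
  obtain ⟨g, hg, hgχ⟩ := hE.homogeneous l _ (E.comp_mem hη hb) χ' hχ'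
  choose σ hσ hσe using fun j : S => hE.homogeneous K _ (E.comp_mem hη (he (some j)).1) _
    (E.comp_mem hη (he none).1)
  let γ' : ι → E.Aut := fun i => if h : i ∈ S then ⟨σ ⟨i, h⟩, hσ _⟩ else γ i
  have hγ' : ∀ i (h : i ∈ S), (γ' i).1 = σ ⟨i, h⟩ := fun i h => by simp only [γ', dif_pos h]
  refine ⟨γ', hγV γ' fun j hj => ?_, ⟨g, hg⟩, fun j x => ?_⟩
  · have hjS : j ∈ S := Finset.mem_union_right _ hj
    rw [hγ' j hjS]
    simp only [hf₀]
    funext x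
    refine congrArg f₀ ?_
    have hφc : ∀ y, φ y = c (e none (η y)) := by
      intro y
      have h1 : φ y = P none (χ y) := congrFun (hP none).2 y
      rw [h1, hηχ]
      exact congrFun (he none).2.1 (η y)
    have h2 : φ ((γ j).1 x) = P (some ⟨j, hjS⟩) (χ x) := congrFun (hP (some ⟨j, hjS⟩)).2 x
    have h3 : e none (η (σ ⟨j, hjS⟩ x)) = e (some ⟨j, hjS⟩) (η x) :=
      (congrFun (hσe ⟨j, hjS⟩) x).symm
    rw [hφc, h3, h2, hηχ]
    exact (congrFun (he (some ⟨j, hjS⟩)).2.1 (η x)).symm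
  · have hjS : (j : ι) ∈ S := Finset.mem_union_left _ j.2
    obtain ⟨y, rfl⟩ := g.surjective x
    have h1 : ((⟨g, hg⟩ * γ' j * ⟨g, hg⟩⁻¹ : E.Aut).1 (g y)) = g (σ ⟨j, hjS⟩ y) := by
      rw [← hγ' j hjS]
      change g ((γ' j).1 (g.symm (g y))) = _
      rw [g.symm_apply_apply]
    rw [h1]
    have hψg : ∀ z, ψ (g z) = Q none (b (η z)) := by
      intro z
      have h2 : ψ (g z) = Q none (χ' (g z)) := congrFun (hQ none).2 (g z)
      rw [h2]
      exact congrArg (Q none) (congrFun hgχ z).symm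
    have hug : u j (g y) = Q (some ⟨j, hjS⟩) (b (η y)) := by
      have h2 : u j (g y) = Q (some ⟨j, hjS⟩) (χ' (g y)) := by
        have := congrFun (hQ (some ⟨j, hjS⟩)).2 (g y)
        simpa [Ψ, j.2] using this
      rw [h2]
      exact congrArg (Q _) (congrFun hgχ y).symm
    have h3 : e none (η (σ ⟨j, hjS⟩ y)) = e (some ⟨j, hjS⟩) (η y) :=
      (congrFun (hσe ⟨j, hjS⟩) y).symm
    have h4 := (he none).2.2 (η (σ ⟨j, hjS⟩ y))
    have h5 := (he (some ⟨j, hjS⟩)).2.2 (η y)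
    rw [h3] at h4
    rw [hψg, hug, Close, abs_le]
    rw [abs_le] at h4 h5
    push_cast
    constructor <;> linarith [h4.1, h4.2, h5.1, h5.2]

/-- The tuples, indexed by any countable set, with dense orbit in `Homeo(P)` are comeager. -/
theorem dense_orbit_mem_residual [CompactSpace X] [TopologicalSpace.MetrizableSpace X]
    [TotallyDisconnectedSpace X] (hE : E.IsLimit) (ι : Type*) [Countable ι] :
    {γ : ι → E.Aut | Dense (E.orbit hE γ)} ∈ residual (ι → E.Aut) := by
  have := E.countable_epi
  let O : (Σ (m : ℕ) (_ : E.Epi m) (F : Finset ι), F → E.Epi m) → Set (ι → E.Aut) :=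
    fun q => E.approxSet q.2.1.1 q.2.2.1 fun j => (q.2.2.2 j).1
  have hO : ⋂ q, O q ∈ residual (ι → E.Aut) :=
    countable_iInter_mem.2 fun q => residual_of_dense_open
      (isOpen_approxSet q.2.1.2 _ _) (dense_approxSet hE q.2.1.2 _ fun j => (q.2.2.2 j).2)
  refine Filter.mem_of_superset hO fun γ hγ => ?_
  rw [Set.mem_ofPred_eq, dense_iff_inter_open]
  rintro U hU ⟨h, hh⟩
  obtain ⟨F, ⟨m, ψ, hψ⟩, hFU⟩ := exists_quoClose hE h (hU.mem_nhds hh)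
  choose δ hδ hδc using fun j => exists_aut_close hE (h j) hψ
  obtain ⟨g, hg⟩ := Set.mem_iInter.1 hγ ⟨m, ⟨ψ, hψ⟩, F, fun j => ⟨ψ ∘ δ j, (hδ j).1 _ _ hψ⟩⟩
  refine ⟨_, hFU (fun i => E.pr hE (g * γ i * g⁻¹)) fun j hj => ?_, g, rfl⟩
  rintro ⟨x⟩
  obtain ⟨z, hz, hzδ⟩ := hδc j x
  exact ⟨z, (g * γ j * g⁻¹ : E.Aut).1 x, hz, rfl,
    (hzδ.trans (hg ⟨j, hj⟩ x).symm le_rfl).mono (by omega)⟩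

end ProPath

end PreProj

/-- The pre-pseudoarc exists, and for every pre-pseudoarc `X` (i.e. every projective Fraïssé limit
of the finite reflexive linear graphs), with quotient space `P`, the tuples whose orbit under
diagonal conjugation by `Aut(X)` is dense in `Homeo(P)^n`, respectively in `Homeo(P)^ℕ`, are comeager
in `Aut(X)^n`, respectively in `Aut(X)^ℕ`. -/
theorem theorem4p1 :
    (∃ (X : Type) (_ : TopologicalSpace X), CompactSpace X ∧ TopologicalSpace.MetrizableSpace X ∧
      TotallyDisconnectedSpace X ∧ ∃ E : PreProj.ProPath X, E.IsLimit) ∧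
    ∀ (X : Type*) [TopologicalSpace X] [CompactSpace X] [TopologicalSpace.MetrizableSpace X]
      [TotallyDisconnectedSpace X] (E : PreProj.ProPath X) (hE : E.IsLimit),
      (∀ n : ℕ, {γ : Fin n → E.Aut | Dense (E.orbit hE γ)} ∈ residual (Fin n → E.Aut)) ∧
      {γ : ℕ → E.Aut | Dense (E.orbit hE γ)} ∈ residual (ℕ → E.Aut) := by

  refine ⟨PreProj.exists_isLimit, fun X _ _ _ _ E hE => ⟨fun n => ?_, ?_⟩⟩
  · exact PreProj.ProPath.dense_orbit_mem_residual hE (Fin n)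
  · exact PreProj.ProPath.dense_orbit_mem_residual hE ℕ
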